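/- Put $\epsilon_1=1$, $\epsilon_2=\epsilon_3=-1$ and take indices modulo 3. Let $(M,\sigma,g)$ be a paraquaternionic K\"ahler manifold: $(M,g)$ is a semi-Riemannian manifold with Levi-Civita connection $\overline\nabla$; $\sigma$ is a rank-3 subbundle of $\mathrm{End}(TM)$ which has, near each point, a smooth basis $J_1,J_2,J_3$ with $J_\alpha^2=-\epsilon_\alpha\mathrm{Id}$ and $J_\alpha J_{\alpha+1}=-J_{\alpha+1}J_\alpha=\epsilon_{\alpha+2}J_{\alpha+2}$ (a canonical local basis); $g(J_\alpha X,J_\alpha Y)=\epsilon_\alpha g(X,Y)$ for every canonical local basis; and $\sigma$ is parallel with respect to $\overline\nabla$. Let $N$ be a paraquaternionic CR-submanifold of $M$: an immersed submanifold whose induced metric $g|_{TN}$ is nondegenerate, together with a smooth distribution $\mathcal D\subseteq TN$ on which $g$ is nondegenerate, such that for every canonical local basis $J_\alpha\mathcal D_x=\mathcal D_x$ and $J_\alpha\mathcal D_x^\perp\subseteq T_xN^\perp$, where $\mathcal D^\perp$ is the orthogonal complement of $\mathcal D$ in $TN$ and $TN^\perp$ is the normal bundle. Let $\nabla$ be the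 Levi-Civita connection of the induced metric. For tangent vector fields $X,Y$ of $N$ let $B(X,Y)$ be the normal part of $\overline\nabla_XY$ (the second fundamental form), and for a normal field $\xi$ let $-A_\xi X$ be the tangential part of $\overline\nabla_X\xi$ (so $A_\xi$ is the shape operator). Let $\nu^\perp_x=J_1\mathcal D_x^\perp+J_2\mathcal D_x^\perp+J_3\mathcal D_x^\perp$, which does not depend on the canonical local basis, and let $\nu$ be the orthogonal complement of $\nu^\perp$ in $TN^\perp$. Then $\mathcal D^\perp$ is integrable (a smooth distribution closed under the Lie bracket), hence defines a foliation $\mathfrak F^\perp$ of $N$, the canonical totally real foliation. Call $\mathfrak F^\perp$ totally geodesic if the second fundamental form of its leaves in $N$ vanishes, i.e. $\nabla_XZ\in\Gamma(\mathcal D^\perp)$ for all $X,Z\in\Gamma(\mathcal D^\perp)$. The following are equivalent: (i) $\mathfrak F^\perp$ is totally geodesic; (ii) $B(X,Y)\in\Gamma(\nu)$ for all $X\in\Gamma(\mathcal D)$, $Y\in\Gamma(\mathcal D^\perp)$; (iii) $A_\xi X\in\Gamma(\mathcal D^\perp)$ for all $X\in\Gamma(\mathcal D^\perp)$, $\xi\in\Gamma(\nu^\perp)$;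 (iv) $A_\xi Y\in\Gamma(\mathcal D)$ for all $Y\in\Gamma(\mathcal D)$, $\xi\in\Gamma(\nu^\perp)$. Moreover, call $N$ mixed geodesic if $B(X,Y)=0$ for all $X\in\Gamma(\mathcal D)$, $Y\in\Gamma(\mathcal D^\perp)$. If $N$ is mixed geodesic, then $\mathfrak F^\perp$ is totally geodesic. If $\nu=0$, then $\mathfrak F^\perp$ is totally geodesic if and only if $N$ is mixed geodesic. -/

import Mathlib

open Bundle Manifold Set
open scoped ContDiff Topology

noncomputable section

/-! Manifolds are Hausdorff, smooth, without boundary, and modelled on a finite-dimensional real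
normed space. A tensor field is a family indexed by the points, its smoothness is stated in the
corresponding Mathlib bundle. -/

/-! ### Linear algebra -/

/-- The vector `z` with `b z w = ℓ w` for all `w`. It exists and is unique when `b` is
nondegenerate, see `sharp_spec`. -/
def sharp {V : Type*} [AddCommGroup V] [Module ℝ V] [TopologicalSpace V]
    (b : V →L[ℝ] V →L[ℝ] ℝ) (ℓ : V → ℝ) : V :=
  Classical.epsilon fun z => ∀ w, b z w = ℓ w

/-- The `b`-orthogonal complement of `W`. -/
def orthCompl {V : Type*} [AddCommGroup V] [Module ℝ V] [TopologicalSpace V]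
    (b : V →L[ℝ] V →L[ℝ] ℝ) (W : Submodule ℝ V) : Submodule ℝ V where
  carrier := {u | ∀ w ∈ W, b w u = 0}
  add_mem' hu hv w hw := by simp [hu w hw, hv w hw]
  zero_mem' w _ := by simp
  smul_mem' c u hu w hw := by simp [hu w hw]

theorem sharp_spec {V : Type*} [AddCommGroup V] [Module ℝ V] [TopologicalSpace V]
    [FiniteDimensional ℝ V] (b : V →L[ℝ] V →L[ℝ] ℝ)
    (hb : ∀ u, (∀ v, b u v = 0) → u = 0) (ℓ : V →ₗ[ℝ] ℝ) (w : V) :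
    b (sharp b ℓ) w = ℓ w := by
  let B : V →ₗ[ℝ] Module.Dual ℝ V :=
    { toFun := fun u => (b u : V →ₗ[ℝ] ℝ)
      map_add' := fun u v => by ext; simp
      map_smul' := fun c u => by ext; simp }
  have hinj : Function.Injective B := by
    rw [injective_iff_map_eq_zero]
    intro u hu
    exact hb u fun v => congrArg (fun φ : Module.Dual ℝ V => φ v) hu
  have hsurj : Function.Surjective B :=
    (LinearMap.injective_iff_surjective_of_finrank_eq_finrank
      (Subspace.dual_finrank_eq (K := ℝ) (V := V)).symm).1 hinj
  obtain ⟨z, hz⟩ := hsurj ℓ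
  have hex : ∃ z, ∀ w, b z w = ℓ w :=
    ⟨z, fun w => congrArg (fun φ : Module.Dual ℝ V => φ w) hz⟩
  exact Classical.epsilon_spec hex w

/-! ### Semi-Riemannian metrics and the Levi-Civita connection -/

section Metric

variable {E : Type*} [NormedAddCommGroup E] [NormedSpace ℝ E]
  {M : Type*} [TopologicalSpace M] [ChartedSpace E M] [IsManifold 𝓘(ℝ, E) ∞ M]
  {F : Type*} [NormedAddCommGroup F] [NormedSpace ℝ F]
  {N : Type*} [TopologicalSpace N] [ChartedSpace F N] [IsManifold 𝓘(ℝ, F) ∞ N]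

/-- `g` is a semi-Riemannian metric: a smooth, symmetric, nondegenerate `(0,2)`-tensor field. -/
structure IsSemiRiemannianMetric
    (g : ∀ p : M, TangentSpace 𝓘(ℝ, E) p →L[ℝ] TangentSpace 𝓘(ℝ, E) p →L[ℝ] ℝ) : Prop where
  contMDiff : ContMDiff 𝓘(ℝ, E) (𝓘(ℝ, E).prod 𝓘(ℝ, E →L[ℝ] E →L[ℝ] ℝ)) ∞
    (fun p => TotalSpace.mk' (E →L[ℝ] E →L[ℝ] ℝ) p (g p))
  symm : ∀ p u v, g p u v = g p v u
  nondegenerate : ∀ p u, (∀ v, g p u v = 0) → u = 0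

/-- The vector field near `p` that has constant components in the chart at `p` and the value `v`
at `p`. -/
def coordField (p : M) (v : TangentSpace 𝓘(ℝ, E) p) (q : M) : TangentSpace 𝓘(ℝ, E) q :=
  (trivializationAt E (TangentSpace 𝓘(ℝ, E) : M → Type _) p).symm q
    ((trivializationAt E (TangentSpace 𝓘(ℝ, E) : M → Type _) p) (TotalSpace.mk' E p v)).2

/-- The Christoffel vector `Γ_p(u, v) = ∇_U V (p)`, where `U`, `V` are the vector fields near `p`
that have constant components in the chart at `p` and the values `u`, `v` at `p`
(`coordField`). Such fields commute, so the Koszul formula reads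
`2 g(∇_U V, W) = U g(V, W) + V g(U, W) - W g(U, V)`. -/
def christoffel (g : ∀ p : M, TangentSpace 𝓘(ℝ, E) p →L[ℝ] TangentSpace 𝓘(ℝ, E) p →L[ℝ] ℝ)
    (p : M) (u v : TangentSpace 𝓘(ℝ, E) p) : TangentSpace 𝓘(ℝ, E) p :=
  sharp (g p) fun w => (1 / 2 : ℝ) *
    (mvfderiv 𝓘(ℝ, E) (fun q => g q (coordField p v q) (coordField p w q)) p u
      + mvfderiv 𝓘(ℝ, E) (fun q => g q (coordField p u q) (coordField p w q)) p v
      - mvfderiv 𝓘(ℝ, E) (fun q => g q (coordField p u q) (coordField p v q)) p w)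

/-- The covariant derivative at `x`, in the direction `v`, of a vector field `V` along
`φ : N → M`, for the Levi-Civita connection of the metric `g` of `M`: in the coordinates of `M`
at `φ x`, the derivative of the components of `V` plus the Christoffel term. -/
def covDerivAlong (g : ∀ p : M, TangentSpace 𝓘(ℝ, E) p →L[ℝ] TangentSpace 𝓘(ℝ, E) p →L[ℝ] ℝ)
    (φ : N → M) (V : ∀ x : N, TangentSpace 𝓘(ℝ, E) (φ x)) (x : N)
    (v : TangentSpace 𝓘(ℝ, F) x) : TangentSpace 𝓘(ℝ, E) (φ x) :=
  (trivializationAt E (TangentSpace 𝓘(ℝ, E) : M → Type _) (φ x)).symm (φ x)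
      (mvfderiv 𝓘(ℝ, F) (fun y : N =>
        ((trivializationAt E (TangentSpace 𝓘(ℝ, E) : M → Type _) (φ x))
          (TotalSpace.mk' E (φ y) (V y))).2) x v)
    + christoffel g (φ x) (mfderiv 𝓘(ℝ, F) 𝓘(ℝ, E) φ x v) (V x)

/-- The Levi-Civita connection of `g`: `leviCivita g Y p v = (∇_v Y)(p)`. -/
def leviCivita (g : ∀ p : M, TangentSpace 𝓘(ℝ, E) p →L[ℝ] TangentSpace 𝓘(ℝ, E) p →L[ℝ] ℝ)
    (Y : ∀ p : M, TangentSpace 𝓘(ℝ, E) p) (p : M) (v : TangentSpace 𝓘(ℝ, E) p) :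
    TangentSpace 𝓘(ℝ, E) p :=
  covDerivAlong g (fun q : M => q) Y p v

/-! ### Distributions and foliations -/

/-- `D` is a smooth distribution of rank `k`. -/
def IsSmoothDistribution (k : ℕ) (D : ∀ x : N, Submodule ℝ (TangentSpace 𝓘(ℝ, F) x)) : Prop :=
  ∀ x : N, ∃ U : Set N, IsOpen U ∧ x ∈ U ∧ ∃ X : Fin k → ∀ y : N, TangentSpace 𝓘(ℝ, F) y,
    (∀ i, ContMDiffOn 𝓘(ℝ, F) 𝓘(ℝ, F).tangent ∞
      (fun y => (TotalSpace.mk' F y (X i y) : TangentBundle 𝓘(ℝ, F) N)) U) ∧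
    ∀ y ∈ U, LinearIndependent ℝ (fun i => X i y) ∧
      Submodule.span ℝ (Set.range fun i => X i y) = D y

/-- `X ∈ Γ(D)`: `X` is a smooth vector field on `N` with values in `D`. -/
def IsSection (D : ∀ x : N, Submodule ℝ (TangentSpace 𝓘(ℝ, F) x))
    (X : ∀ x : N, TangentSpace 𝓘(ℝ, F) x) : Prop :=
  ContMDiff 𝓘(ℝ, F) 𝓘(ℝ, F).tangent ∞
    (fun x => (TotalSpace.mk' F x (X x) : TangentBundle 𝓘(ℝ, F) N)) ∧ ∀ x, X x ∈ D x

variable (F) in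
/-- `ξ ∈ Γ(W)`: `ξ` is a smooth vector field along `f : N → M` with values in `W`. -/
def IsSectionAlong (f : N → M) (W : ∀ x : N, Submodule ℝ (TangentSpace 𝓘(ℝ, E) (f x)))
    (ξ : ∀ x : N, TangentSpace 𝓘(ℝ, E) (f x)) : Prop :=
  ContMDiff 𝓘(ℝ, F) 𝓘(ℝ, E).tangent ∞
    (fun x => (TotalSpace.mk' E (f x) (ξ x) : TangentBundle 𝓘(ℝ, E) M)) ∧ ∀ x, ξ x ∈ W x

/-- `D` is the structural distribution of a foliation: a smooth distribution of constant rank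
that is integrable, i.e. closed under the Lie bracket. -/
def IsFoliation (D : ∀ x : N, Submodule ℝ (TangentSpace 𝓘(ℝ, F) x)) : Prop :=
  (∃ k, IsSmoothDistribution k D) ∧
  ∀ X Z : ∀ x : N, TangentSpace 𝓘(ℝ, F) x, IsSection D X → IsSection D Z →
    ∀ x, VectorField.mlieBracket 𝓘(ℝ, F) X Z x ∈ D x

/-- The foliation with structural distribution `D` is totally geodesic in `(N, h)`: the second
fundamental form of its leaves, i.e. the part of `∇_X Z` outside `D` for `X, Z ∈ Γ(D)`,
vanishes. -/
def IsTotallyGeodesicFoliation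
    (h : ∀ x : N, TangentSpace 𝓘(ℝ, F) x →L[ℝ] TangentSpace 𝓘(ℝ, F) x →L[ℝ] ℝ)
    (D : ∀ x : N, Submodule ℝ (TangentSpace 𝓘(ℝ, F) x)) : Prop :=
  IsFoliation D ∧
  ∀ X Z : ∀ x : N, TangentSpace 𝓘(ℝ, F) x, IsSection D X → IsSection D Z →
    ∀ x, leviCivita h Z x (X x) ∈ D x

/-! ### Nondegenerate submanifolds -/

variable (F) in
/-- The metric on `N` induced by `f : N → M`. -/
def inducedMetric (g : ∀ p : M, TangentSpace 𝓘(ℝ, E) p →L[ℝ] TangentSpace 𝓘(ℝ, E) p →L[ℝ] ℝ)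
    (f : N → M) (x : N) : TangentSpace 𝓘(ℝ, F) x →L[ℝ] TangentSpace 𝓘(ℝ, F) x →L[ℝ] ℝ :=
  ((mfderiv 𝓘(ℝ, F) 𝓘(ℝ, E) f x).precomp ℝ) ∘L (g (f x)) ∘L (mfderiv 𝓘(ℝ, F) 𝓘(ℝ, E) f x)

variable (F) in
/-- `f : N → M` is an immersed submanifold of `(M, g)` whose induced metric is nondegenerate. -/
structure IsNondegenerateSubmanifold
    (g : ∀ p : M, TangentSpace 𝓘(ℝ, E) p →L[ℝ] TangentSpace 𝓘(ℝ, E) p →L[ℝ] ℝ)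
    (f : N → M) : Prop where
  contMDiff : ContMDiff 𝓘(ℝ, F) 𝓘(ℝ, E) ∞ f
  immersion : ∀ x, Function.Injective (mfderiv 𝓘(ℝ, F) 𝓘(ℝ, E) f x)
  nondegenerate : ∀ (x : N) (u : TangentSpace 𝓘(ℝ, F) x), (∀ v, inducedMetric F g f x u v = 0) → u = 0

variable (F) in
/-- The normal space `T_x N^⊥ ⊆ T_{f x} M`. -/
def normalSpace (g : ∀ p : M, TangentSpace 𝓘(ℝ, E) p →L[ℝ] TangentSpace 𝓘(ℝ, E) p →L[ℝ] ℝ)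
    (f : N → M) (x : N) : Submodule ℝ (TangentSpace 𝓘(ℝ, E) (f x)) :=
  orthCompl (g (f x))
    (mfderiv 𝓘(ℝ, F) 𝓘(ℝ, E) f x :
      TangentSpace 𝓘(ℝ, F) x →ₗ[ℝ] TangentSpace 𝓘(ℝ, E) (f x)).range

variable (F) in
/-- The tangential part of `w ∈ T_{f x} M`, as an element of `T_x N`. -/
def tangentialPart
    (g : ∀ p : M, TangentSpace 𝓘(ℝ, E) p →L[ℝ] TangentSpace 𝓘(ℝ, E) p →L[ℝ] ℝ)
    (f : N → M) (x : N) (w : TangentSpace 𝓘(ℝ, E) (f x)) : TangentSpace 𝓘(ℝ, F) x :=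
  sharp (inducedMetric F g f x) fun v => g (f x) w (mfderiv 𝓘(ℝ, F) 𝓘(ℝ, E) f x v)

variable (F) in
/-- The normal part of `w ∈ T_{f x} M`. -/
def normalPart (g : ∀ p : M, TangentSpace 𝓘(ℝ, E) p →L[ℝ] TangentSpace 𝓘(ℝ, E) p →L[ℝ] ℝ)
    (f : N → M) (x : N) (w : TangentSpace 𝓘(ℝ, E) (f x)) : TangentSpace 𝓘(ℝ, E) (f x) :=
  w - mfderiv 𝓘(ℝ, F) 𝓘(ℝ, E) f x (tangentialPart F g f x w)

/-- The second fundamental form `B(X, Y)` of `N` in `M`, the normal part of the derivative of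
`Y` in the direction `X` for the Levi-Civita connection of `M`. -/
def secondFundamentalForm
    (g : ∀ p : M, TangentSpace 𝓘(ℝ, E) p →L[ℝ] TangentSpace 𝓘(ℝ, E) p →L[ℝ] ℝ)
    (f : N → M) (X Y : ∀ x : N, TangentSpace 𝓘(ℝ, F) x) (x : N) :
    TangentSpace 𝓘(ℝ, E) (f x) :=
  normalPart F g f x
    (covDerivAlong g f (fun y => mfderiv 𝓘(ℝ, F) 𝓘(ℝ, E) f y (Y y)) x (X x))

/-- The shape operator `A_ξ X`: `-A_ξ X` is the tangential part of the derivative of `ξ` in the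
direction `X` for the Levi-Civita connection of `M`. -/
def shapeOperator
    (g : ∀ p : M, TangentSpace 𝓘(ℝ, E) p →L[ℝ] TangentSpace 𝓘(ℝ, E) p →L[ℝ] ℝ)
    (f : N → M) (ξ : ∀ x : N, TangentSpace 𝓘(ℝ, E) (f x))
    (X : ∀ x : N, TangentSpace 𝓘(ℝ, F) x) (x : N) : TangentSpace 𝓘(ℝ, F) x :=
  -tangentialPart F g f x (covDerivAlong g f ξ x (X x))

end Metric

/-! ### Paraquaternionic Kähler manifolds -/

section Paraquaternionic

variable {E : Type*} [NormedAddCommGroup E] [NormedSpace ℝ E]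
  {M : Type*} [TopologicalSpace M] [ChartedSpace E M] [IsManifold 𝓘(ℝ, E) ∞ M]
  {F : Type*} [NormedAddCommGroup F] [NormedSpace ℝ F]
  {N : Type*} [TopologicalSpace N] [ChartedSpace F N] [IsManifold 𝓘(ℝ, F) ∞ N]

/-- The signs `ε₁ = 1`, `ε₂ = ε₃ = -1`; the indices `1, 2, 3` are `0, 1, 2 : Fin 3`. -/
def pqSign : Fin 3 → ℝ := ![1, -1, -1]

/-- A field of endomorphisms of the tangent spaces is smooth on `U`. -/
def IsSmoothEndOn (S : ∀ p : M, TangentSpace 𝓘(ℝ, E) p →L[ℝ] TangentSpace 𝓘(ℝ, E) p)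
    (U : Set M) : Prop :=
  ContMDiffOn 𝓘(ℝ, E) (𝓘(ℝ, E).prod 𝓘(ℝ, E →L[ℝ] E)) ∞
    (fun p => TotalSpace.mk' (E →L[ℝ] E) p (S p)) U

/-- `J₁, J₂, J₃` is a canonical local basis of `σ ⊆ End(TM)` on the open set `U`:
`J_α² = -ε_α Id` and `J_α J_{α+1} = -J_{α+1} J_α = ε_{α+2} J_{α+2}`, indices modulo `3`. -/
structure IsCanonicalLocalBasis
    (σ : ∀ p : M, Submodule ℝ (TangentSpace 𝓘(ℝ, E) p →L[ℝ] TangentSpace 𝓘(ℝ, E) p))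
    (U : Set M)
    (J : Fin 3 → ∀ p : M, TangentSpace 𝓘(ℝ, E) p →L[ℝ] TangentSpace 𝓘(ℝ, E) p) : Prop where
  isOpen : IsOpen U
  smooth : ∀ α, IsSmoothEndOn (J α) U
  linearIndependent : ∀ p ∈ U, LinearIndependent ℝ fun α => J α p
  span_eq : ∀ p ∈ U, Submodule.span ℝ (Set.range fun α => J α p) = σ p
  sq : ∀ p ∈ U, ∀ α, J α p ∘L J α p = -pqSign α • ContinuousLinearMap.id ℝ _
  mul : ∀ p ∈ U, ∀ α, J α p ∘L J (α + 1) p = pqSign (α + 2) • J (α + 2) p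
  anticomm : ∀ p ∈ U, ∀ α, J α p ∘L J (α + 1) p = -(J (α + 1) p ∘L J α p)

/-- `σ` is an almost paraquaternionic structure on `M`. -/
def IsAlmostParaquaternionic
    (σ : ∀ p : M, Submodule ℝ (TangentSpace 𝓘(ℝ, E) p →L[ℝ] TangentSpace 𝓘(ℝ, E) p)) : Prop :=
  ∀ p : M, ∃ U J, p ∈ U ∧ IsCanonicalLocalBasis σ U J

/-- `(M, σ, g)` is an almost paraquaternionic hermitian manifold. -/
structure IsAlmostParaquaternionicHermitian
    (g : ∀ p : M, TangentSpace 𝓘(ℝ, E) p →L[ℝ] TangentSpace 𝓘(ℝ, E) p →L[ℝ] ℝ)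
    (σ : ∀ p : M, Submodule ℝ (TangentSpace 𝓘(ℝ, E) p →L[ℝ] TangentSpace 𝓘(ℝ, E) p)) :
    Prop where
  metric : IsSemiRiemannianMetric g
  almost : IsAlmostParaquaternionic σ
  adapted : ∀ U J, IsCanonicalLocalBasis σ U J → ∀ p ∈ U, ∀ α u v,
    g p (J α p u) (J α p v) = pqSign α * g p u v

/-- `(M, σ, g)` is a paraquaternionic Kähler manifold: moreover `σ` is parallel for the
Levi-Civita connection, i.e. for each local section `S` of `σ` and each tangent vector `v` the
endomorphism `∇_v S`, given by `(∇_v S) Y = ∇_v (S Y) - S (∇_v Y)`, belongs to `σ`. -/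
structure IsParaquaternionicKahler
    (g : ∀ p : M, TangentSpace 𝓘(ℝ, E) p →L[ℝ] TangentSpace 𝓘(ℝ, E) p →L[ℝ] ℝ)
    (σ : ∀ p : M, Submodule ℝ (TangentSpace 𝓘(ℝ, E) p →L[ℝ] TangentSpace 𝓘(ℝ, E) p)) :
    Prop extends IsAlmostParaquaternionicHermitian g σ where
  parallel : ∀ (U : Set M) (S : ∀ p : M, TangentSpace 𝓘(ℝ, E) p →L[ℝ] TangentSpace 𝓘(ℝ, E) p),
    IsOpen U → IsSmoothEndOn S U → (∀ p ∈ U, S p ∈ σ p) →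
    ∀ p ∈ U, ∀ v : TangentSpace 𝓘(ℝ, E) p, ∃ T ∈ σ p,
      ∀ Y : ∀ q : M, TangentSpace 𝓘(ℝ, E) q,
        ContMDiffAt 𝓘(ℝ, E) 𝓘(ℝ, E).tangent ∞
          (fun q => (TotalSpace.mk' E q (Y q) : TangentBundle 𝓘(ℝ, E) M)) p →
        leviCivita g (fun q => S q (Y q)) p v - S p (leviCivita g Y p v) = T (Y p)

/-! ### Paraquaternionic CR-submanifolds -/

/-- The orthogonal complement `D^⊥` of a distribution `D` in `TN`. -/
def distPerp (g : ∀ p : M, TangentSpace 𝓘(ℝ, E) p →L[ℝ] TangentSpace 𝓘(ℝ, E) p →L[ℝ] ℝ)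
    (f : N → M) (D : ∀ x : N, Submodule ℝ (TangentSpace 𝓘(ℝ, F) x)) (x : N) :
    Submodule ℝ (TangentSpace 𝓘(ℝ, F) x) :=
  orthCompl (inducedMetric F g f x) (D x)

/-- The image of `W ⊆ T_x N` in `T_{f x} M`. -/
def tangentImage (f : N → M) (x : N) (W : Submodule ℝ (TangentSpace 𝓘(ℝ, F) x)) :
    Submodule ℝ (TangentSpace 𝓘(ℝ, E) (f x)) :=
  W.map (mfderiv 𝓘(ℝ, F) 𝓘(ℝ, E) f x :
    TangentSpace 𝓘(ℝ, F) x →ₗ[ℝ] TangentSpace 𝓘(ℝ, E) (f x))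

/-- `f : N → M` is a paraquaternionic CR-submanifold of `(M, σ, g)`, with paraquaternionic
distribution `D` and totally real distribution `D^⊥`. -/
structure IsParaquaternionicCR
    (g : ∀ p : M, TangentSpace 𝓘(ℝ, E) p →L[ℝ] TangentSpace 𝓘(ℝ, E) p →L[ℝ] ℝ)
    (σ : ∀ p : M, Submodule ℝ (TangentSpace 𝓘(ℝ, E) p →L[ℝ] TangentSpace 𝓘(ℝ, E) p))
    (f : N → M) (D : ∀ x : N, Submodule ℝ (TangentSpace 𝓘(ℝ, F) x)) : Prop
    extends IsNondegenerateSubmanifold F g f where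
  distribution : ∃ k, IsSmoothDistribution k D
  dist_nondegenerate : ∀ x, ∀ u ∈ D x, (∀ v ∈ D x, inducedMetric F g f x u v = 0) → u = 0
  paraquaternionic : ∀ U J, IsCanonicalLocalBasis σ U J → ∀ x, f x ∈ U → ∀ α,
    (tangentImage f x (D x)).map
        (J α (f x) : TangentSpace 𝓘(ℝ, E) (f x) →ₗ[ℝ] TangentSpace 𝓘(ℝ, E) (f x))
      = tangentImage f x (D x)
  totallyReal : ∀ U J, IsCanonicalLocalBasis σ U J → ∀ x, f x ∈ U → ∀ α,
    (tangentImage f x (distPerp g f D x)).map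
      (J α (f x) : TangentSpace 𝓘(ℝ, E) (f x) →ₗ[ℝ] TangentSpace 𝓘(ℝ, E) (f x)) ≤ normalSpace F g f x

/-- `ν_x^⊥`, the sum of the images of `D_x^⊥` under the elements of `σ`; by
`nuPerp_eq` it is `J₁ D_x^⊥ + J₂ D_x^⊥ + J₃ D_x^⊥` for each canonical local basis. -/
def nuPerp (g : ∀ p : M, TangentSpace 𝓘(ℝ, E) p →L[ℝ] TangentSpace 𝓘(ℝ, E) p →L[ℝ] ℝ)
    (σ : ∀ p : M, Submodule ℝ (TangentSpace 𝓘(ℝ, E) p →L[ℝ] TangentSpace 𝓘(ℝ, E) p))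
    (f : N → M) (D : ∀ x : N, Submodule ℝ (TangentSpace 𝓘(ℝ, F) x)) (x : N) :
    Submodule ℝ (TangentSpace 𝓘(ℝ, E) (f x)) :=
  ⨆ S ∈ σ (f x), (tangentImage f x (distPerp g f D x)).map
    (S : TangentSpace 𝓘(ℝ, E) (f x) →ₗ[ℝ] TangentSpace 𝓘(ℝ, E) (f x))

set_option linter.unusedSectionVars false in
theorem nuPerp_eq
    (g : ∀ p : M, TangentSpace 𝓘(ℝ, E) p →L[ℝ] TangentSpace 𝓘(ℝ, E) p →L[ℝ] ℝ)
    (σ : ∀ p : M, Submodule ℝ (TangentSpace 𝓘(ℝ, E) p →L[ℝ] TangentSpace 𝓘(ℝ, E) p))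
    (f : N → M) (D : ∀ x : N, Submodule ℝ (TangentSpace 𝓘(ℝ, F) x)) {U : Set M}
    {J : Fin 3 → ∀ p : M, TangentSpace 𝓘(ℝ, E) p →L[ℝ] TangentSpace 𝓘(ℝ, E) p}
    (hJ : IsCanonicalLocalBasis σ U J) (x : N) (hx : f x ∈ U) :
    nuPerp g σ f D x = ⨆ α, (tangentImage f x (distPerp g f D x)).map
      (J α (f x) : TangentSpace 𝓘(ℝ, E) (f x) →ₗ[ℝ] TangentSpace 𝓘(ℝ, E) (f x)) := by
  apply le_antisymm
  · refine iSup₂_le fun S hS => ?_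
    rw [← hJ.span_eq _ hx] at hS
    rintro _ ⟨u, hu, rfl⟩
    induction hS using Submodule.span_induction with
    | mem S hS =>
      obtain ⟨α, rfl⟩ := hS
      exact Submodule.mem_iSup_of_mem α ⟨u, hu, rfl⟩
    | zero => exact Submodule.zero_mem _
    | add S T _ _ h1 h2 => exact Submodule.add_mem _ h1 h2
    | smul c S _ h => exact Submodule.smul_mem _ c h
  · refine iSup_le fun α => ?_
    refine le_iSup₂_of_le (J α (f x)) ?_ le_rfl
    rw [← hJ.span_eq _ hx]
    exact Submodule.subset_span ⟨α, rfl⟩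

/-- `ν_x`, the orthogonal complement of `ν_x^⊥` in the normal space `T_x N^⊥`. -/
def nu (g : ∀ p : M, TangentSpace 𝓘(ℝ, E) p →L[ℝ] TangentSpace 𝓘(ℝ, E) p →L[ℝ] ℝ)
    (σ : ∀ p : M, Submodule ℝ (TangentSpace 𝓘(ℝ, E) p →L[ℝ] TangentSpace 𝓘(ℝ, E) p))
    (f : N → M) (D : ∀ x : N, Submodule ℝ (TangentSpace 𝓘(ℝ, F) x)) (x : N) :
    Submodule ℝ (TangentSpace 𝓘(ℝ, E) (f x)) :=
  normalSpace F g f x ⊓ orthCompl (g (f x)) (nuPerp g σ f D x)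

/-- `N` is mixed geodesic: `B(X, Y) = 0` for `X ∈ Γ(D)`, `Y ∈ Γ(D^⊥)`. -/
def IsMixedGeodesic
    (g : ∀ p : M, TangentSpace 𝓘(ℝ, E) p →L[ℝ] TangentSpace 𝓘(ℝ, E) p →L[ℝ] ℝ)
    (f : N → M) (D : ∀ x : N, Submodule ℝ (TangentSpace 𝓘(ℝ, F) x)) : Prop :=
  ∀ X Y : ∀ x : N, TangentSpace 𝓘(ℝ, F) x, IsSection D X → IsSection (distPerp g f D) Y →
    ∀ x, secondFundamentalForm g f X Y x = 0

end Paraquaternionic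

end

/-! Write `∇'` for the Levi-Civita connection of `M`, `h` for the induced metric, and suppress the
differential of `f`. Every condition of the theorem is compared with one scalar condition,
`IsNuPerpOrthogonal`: `g(n, ∇'_X Y) = 0` for `X ∈ Γ(D^⊥)`, `Y ∈ Γ(D)` and `n ∈ ν^⊥`.

The link with the leaves is `apply_covDerivTangent_shift`. Let `Z ∈ Γ(D^⊥)`, let `y` be a tangent
vector and let `Y ∈ Γ(D)` take the value `J_α y` at the point. Then `ε_α g(∇'_X Z, y) = g(J_α ∇'_X
Z, Y)`. Since `σ` is parallel, `∇'_X (J_α Z)` differs from `J_α ∇'_X Z` by a value of an element of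
`σ` on `Z`; that value lies in `ν^⊥`, is normal, and is not seen by `Y`. Differentiating `g(J_α Z,
Y) = 0` then gives `-g(J_α Z, ∇'_X Y)`. By the Gauss formula the left side is `ε_α h(∇_X Z, y)`, and
`J_α` maps `D` onto itself, so `∇_X Z ⊥ D` for all `X`, `Z` is the scalar condition.

Integrability comes from the same identity, because `g(J_α Z, ∇'_X Y)` is symmetric in `X, Z ∈
Γ(D^⊥)` (`apply_covDerivTangent_symm`); hence `∇'_X Z - ∇'_Z X = [X, Z]` is orthogonal to `D`.

The other conditions restate the scalar one. As `B` is symmetric, `g(n, B(Y, X)) = g(n, ∇'_X Y)`.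
Differentiating `g(ξ, Y) = 0` gives `h(A_ξ X, Y) = g(ξ, ∇'_X Y)`, which treats `A_ξ` on `D^⊥`; on
`D` the symmetry of `B` and `D = (D^⊥)^⊥` are used as well. Mixed geodesic means `B = 0` on `D ×
D^⊥`, which implies `B ∈ ν` and is equivalent to it when `ν = 0`.

The preparatory work derives from the coordinate definition of the connection that it is metric,
torsion-free and compatible with pullback along `f`, and shows that `D^⊥` is a smooth distribution
with enough global sections. -/

noncomputable section

/-! ### The connection in coordinates: linearity, Leibniz rule, compatibility with the metric. -/

section Connection

variable {E : Type*} [NormedAddCommGroup E] [NormedSpace ℝ E]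
  {M : Type*} [TopologicalSpace M] [ChartedSpace E M] [IsManifold 𝓘(ℝ, E) ∞ M]
  {F : Type*} [NormedAddCommGroup F] [NormedSpace ℝ F]
  {N : Type*} [TopologicalSpace N] [ChartedSpace F N]

theorem Filter.EventuallyEq.mvfderiv_eq {G : Type*} [NormedAddCommGroup G] [NormedSpace ℝ G]
    {a b : N → G} {x : N} (h : a =ᶠ[𝓝 x] b) :
    mvfderiv 𝓘(ℝ, F) a x = mvfderiv 𝓘(ℝ, F) b x := by
  ext v
  simp only [mvfderiv, h.mfderiv_eq]
  rfl

/-- The components, in the chart at `p`, of a tangent vector at `q`. -/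
def coordMap (p q : M) : TangentSpace 𝓘(ℝ, E) q →L[ℝ] E :=
  (trivializationAt E (TangentSpace 𝓘(ℝ, E) : M → Type _) p).continuousLinearMapAt ℝ q

/-- The tangent vector at `q` with given components in the chart at `p`. -/
def frameMap (p q : M) : E →L[ℝ] TangentSpace 𝓘(ℝ, E) q :=
  (trivializationAt E (TangentSpace 𝓘(ℝ, E) : M → Type _) p).symmL ℝ q

variable (E) in
theorem eventually_mem_baseSet (p : M) :
    ∀ᶠ q in 𝓝 p, q ∈ (trivializationAt E (TangentSpace 𝓘(ℝ, E) : M → Type _) p).baseSet :=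
  (trivializationAt E (TangentSpace 𝓘(ℝ, E) : M → Type _) p).open_baseSet.mem_nhds
    (FiberBundle.mem_baseSet_trivializationAt' p)

theorem coordMap_apply {p q : M}
    (hq : q ∈ (trivializationAt E (TangentSpace 𝓘(ℝ, E) : M → Type _) p).baseSet)
    (v : TangentSpace 𝓘(ℝ, E) q) :
    (trivializationAt E (TangentSpace 𝓘(ℝ, E) : M → Type _) p (TotalSpace.mk' E q v)).2
      = coordMap p q v := by
  rw [coordMap, Trivialization.continuousLinearMapAt_apply, Trivialization.linearMapAt_apply,
    if_pos hq]

theorem frameMap_apply {p q : M}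
    (hq : q ∈ (trivializationAt E (TangentSpace 𝓘(ℝ, E) : M → Type _) p).baseSet) (e : E) :
    (trivializationAt E (TangentSpace 𝓘(ℝ, E) : M → Type _) p).symm q e = frameMap p q e :=
  (Trivialization.symmL_apply _ hq e).symm

theorem frameMap_coordMap {p q : M}
    (hq : q ∈ (trivializationAt E (TangentSpace 𝓘(ℝ, E) : M → Type _) p).baseSet)
    (v : TangentSpace 𝓘(ℝ, E) q) : frameMap p q (coordMap p q v) = v :=
  (trivializationAt E (TangentSpace 𝓘(ℝ, E) : M → Type _) p).symmL_continuousLinearMapAt hq v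

theorem coordMap_frameMap {p q : M}
    (hq : q ∈ (trivializationAt E (TangentSpace 𝓘(ℝ, E) : M → Type _) p).baseSet)
    (e : E) : coordMap p q (frameMap p q e) = e :=
  (trivializationAt E (TangentSpace 𝓘(ℝ, E) : M → Type _) p).continuousLinearMapAt_symmL hq e

theorem frameMap_coordMap_self (p : M) (v : TangentSpace 𝓘(ℝ, E) p) :
    frameMap p p (coordMap p p v) = v :=
  frameMap_coordMap (FiberBundle.mem_baseSet_trivializationAt' p) v

theorem coordMap_frameMap_self (p : M) (e : E) : coordMap p p (frameMap p p e) = e :=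
  coordMap_frameMap (FiberBundle.mem_baseSet_trivializationAt' p) e

/-- The vector field near `p` that has constant components in the chart at `p` and the value `v`
at `p`, as a linear function of `v`. -/
def frameField (p : M) (v : TangentSpace 𝓘(ℝ, E) p) (q : M) : TangentSpace 𝓘(ℝ, E) q :=
  frameMap p q (coordMap p p v)

theorem frameField_eq (p : M) (v : TangentSpace 𝓘(ℝ, E) p) (q : M) :
    frameField p v q = frameMap p q (coordMap p p v) := rfl

/-- The inverse trivialization is compared with a linear map only over its base set. `frameField` is
linear in `v` at every `q`, so it replaces `coordField` wherever only germs at `p` matter, in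
particular under a derivative. -/
theorem coordField_eventuallyEq (p : M) :
    ∀ᶠ q in 𝓝 p, ∀ v : TangentSpace 𝓘(ℝ, E) p, coordField p v q = frameField p v q := by
  filter_upwards [eventually_mem_baseSet E p] with q hq v
  rw [coordField, coordMap_apply (FiberBundle.mem_baseSet_trivializationAt' p),
    frameMap_apply hq, frameField_eq]

theorem frameField_self (p : M) (v : TangentSpace 𝓘(ℝ, E) p) : frameField p v p = v := by
  rw [frameField_eq, frameMap_coordMap_self]

theorem frameField_frameMap (p q : M) (e : E) :
    frameField p (frameMap p p e) q = frameMap p q e := by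
  rw [frameField_eq, coordMap_frameMap_self]

theorem frameField_add (p : M) (v w : TangentSpace 𝓘(ℝ, E) p) (q : M) :
    frameField p (v + w) q = frameField p v q + frameField p w q := by
  simp only [frameField_eq, map_add]

theorem frameField_smul (p : M) (c : ℝ) (v : TangentSpace 𝓘(ℝ, E) p) (q : M) :
    frameField p (c • v) q = c • frameField p v q := by
  simp only [frameField_eq, map_smul]

variable (E F) in
/-- The vector field `V` along `φ` is differentiable at `x`. -/
def DiffAlong (φ : N → M) (V : ∀ x : N, TangentSpace 𝓘(ℝ, E) (φ x)) (x : N) : Prop :=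
  MDifferentiableAt 𝓘(ℝ, F) 𝓘(ℝ, E) (fun y => coordMap (φ x) (φ y) (V y)) x

section Along

variable {φ : N → M} {x : N}

variable (E) in
theorem eventually_mem_baseSet_comp (hφ : ContinuousAt φ x) :
    ∀ᶠ y in 𝓝 x,
      φ y ∈ (trivializationAt E (TangentSpace 𝓘(ℝ, E) : M → Type _) (φ x)).baseSet :=
  hφ.eventually (eventually_mem_baseSet E (φ x))

theorem trivialization_eventuallyEq (hφ : ContinuousAt φ x)
    (V : ∀ x : N, TangentSpace 𝓘(ℝ, E) (φ x)) :
    (fun y => (trivializationAt E (TangentSpace 𝓘(ℝ, E) : M → Type _) (φ x)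
      (TotalSpace.mk' E (φ y) (V y))).2) =ᶠ[𝓝 x] fun y => coordMap (φ x) (φ y) (V y) := by
  filter_upwards [eventually_mem_baseSet_comp E hφ] with y hy
  exact coordMap_apply hy _

theorem covDerivAlong_eq
    (g : ∀ p : M, TangentSpace 𝓘(ℝ, E) p →L[ℝ] TangentSpace 𝓘(ℝ, E) p →L[ℝ] ℝ)
    (hφ : ContinuousAt φ x) (V : ∀ x : N, TangentSpace 𝓘(ℝ, E) (φ x))
    (v : TangentSpace 𝓘(ℝ, F) x) :
    covDerivAlong g φ V x v
      = frameMap (φ x) (φ x) (mvfderiv 𝓘(ℝ, F) (fun y : N => coordMap (φ x) (φ y) (V y)) x v)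
        + christoffel g (φ x) (mfderiv 𝓘(ℝ, F) 𝓘(ℝ, E) φ x v) (V x) := by
  rw [covDerivAlong, frameMap_apply (FiberBundle.mem_baseSet_trivializationAt' (φ x)), (trivialization_eventuallyEq hφ V).mvfderiv_eq]

theorem ContMDiffAt.diffAlong {V : ∀ x : N, TangentSpace 𝓘(ℝ, E) (φ x)}
    (hV : ContMDiffAt 𝓘(ℝ, F) 𝓘(ℝ, E).tangent ∞
      (fun x => (TotalSpace.mk' E (φ x) (V x) : TangentBundle 𝓘(ℝ, E) M)) x) :
    DiffAlong E F φ V x := by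
  rw [contMDiffAt_totalSpace] at hV
  exact ((hV.2.mdifferentiableAt (by simp)).congr_of_eventuallyEq
    (trivialization_eventuallyEq hV.1.continuousAt V).symm)

theorem DiffAlong.add {V W : ∀ x : N, TangentSpace 𝓘(ℝ, E) (φ x)} (hV : DiffAlong E F φ V x)
    (hW : DiffAlong E F φ W x) : DiffAlong E F φ (fun y => V y + W y) x := by
  simp only [DiffAlong, map_add]
  exact MDifferentiableAt.add hV hW

theorem DiffAlong.smul {c : N → ℝ} {V : ∀ x : N, TangentSpace 𝓘(ℝ, E) (φ x)}
    (hc : MDifferentiableAt 𝓘(ℝ, F) 𝓘(ℝ, ℝ) c x) (hV : DiffAlong E F φ V x) :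
    DiffAlong E F φ (fun y => c y • V y) x := by
  simp only [DiffAlong, map_smul]
  exact MDifferentiableAt.smul hc hV

theorem DiffAlong.congr {V W : ∀ x : N, TangentSpace 𝓘(ℝ, E) (φ x)} (hV : DiffAlong E F φ V x)
    (h : ∀ᶠ y in 𝓝 x, W y = V y) : DiffAlong E F φ W x := by
  refine MDifferentiableAt.congr_of_eventuallyEq hV ?_
  filter_upwards [h] with y hy
  rw [hy]

theorem diffAlong_frameField (hφ : ContinuousAt φ x) (v : TangentSpace 𝓘(ℝ, E) (φ x)) :
    DiffAlong E F φ (fun y => frameField (φ x) v (φ y)) x := by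
  refine (mdifferentiableAt_const (c := coordMap (φ x) (φ x) v)).congr_of_eventuallyEq ?_
  filter_upwards [eventually_mem_baseSet_comp E hφ] with y hy
  rw [frameField_eq, coordMap_frameMap hy]

variable (g : ∀ p : M, TangentSpace 𝓘(ℝ, E) p →L[ℝ] TangentSpace 𝓘(ℝ, E) p →L[ℝ] ℝ)

theorem covDerivAlong_congr (hφ : ContinuousAt φ x)
    {V W : ∀ x : N, TangentSpace 𝓘(ℝ, E) (φ x)}
    (h : ∀ᶠ y in 𝓝 x, V y = W y) (v : TangentSpace 𝓘(ℝ, F) x) :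
    covDerivAlong g φ V x v = covDerivAlong g φ W x v := by
  have h' : (fun y => coordMap (φ x) (φ y) (V y)) =ᶠ[𝓝 x]
      fun y => coordMap (φ x) (φ y) (W y) := by
    filter_upwards [h] with y hy
    rw [hy]
  rw [covDerivAlong_eq g hφ, covDerivAlong_eq g hφ, h.self_of_nhds, h'.mvfderiv_eq]

/-- `g` has differentiable components at `p`, in the chart at `p`. -/
def HasDiffComponentsAt (p : M) : Prop :=
  ∀ u v : TangentSpace 𝓘(ℝ, E) p,
    MDifferentiableAt 𝓘(ℝ, E) 𝓘(ℝ, ℝ) (fun q => g q (frameField p u q) (frameField p v q)) p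

variable {g}

section Christoffel

variable {p : M}

theorem christoffel_eq (u v : TangentSpace 𝓘(ℝ, E) p) :
    christoffel g p u v = sharp (g p) fun w => (1 / 2 : ℝ) *
    (mvfderiv 𝓘(ℝ, E) (fun q => g q (frameField p v q) (frameField p w q)) p u
      + mvfderiv 𝓘(ℝ, E) (fun q => g q (frameField p u q) (frameField p w q)) p v
      - mvfderiv 𝓘(ℝ, E) (fun q => g q (frameField p u q) (frameField p v q)) p w) := by
  have h : ∀ a b : TangentSpace 𝓘(ℝ, E) p,
      (fun q => g q (coordField p a q) (coordField p b q)) =ᶠ[𝓝 p]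
        fun q => g q (frameField p a q) (frameField p b q) := fun a b => by
    filter_upwards [coordField_eventuallyEq (E := E) p] with q hq
    rw [hq, hq]
  simp only [christoffel, (h _ _).mvfderiv_eq]

/-- `sharp` has its defining property only for a linear functional. Linearity in `w` of the Koszul
expression rests on the differentiability of the metric components. -/
theorem christoffel_spec [FiniteDimensional ℝ E] (hg : HasDiffComponentsAt g p)
    (hnd : ∀ u, (∀ v, g p u v = 0) → u = 0) (u v w : TangentSpace 𝓘(ℝ, E) p) :
    g p (christoffel g p u v) w = (1 / 2 : ℝ) *
    (mvfderiv 𝓘(ℝ, E) (fun q => g q (frameField p v q) (frameField p w q)) p u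
      + mvfderiv 𝓘(ℝ, E) (fun q => g q (frameField p u q) (frameField p w q)) p v
      - mvfderiv 𝓘(ℝ, E) (fun q => g q (frameField p u q) (frameField p v q)) p w) := by
  have : FiniteDimensional ℝ (TangentSpace 𝓘(ℝ, E) p) := ‹FiniteDimensional ℝ E›
  let ℓ : TangentSpace 𝓘(ℝ, E) p →ₗ[ℝ] ℝ :=
    { toFun := fun w => (1 / 2 : ℝ) *
        (mvfderiv 𝓘(ℝ, E) (fun q => g q (frameField p v q) (frameField p w q)) p u
          + mvfderiv 𝓘(ℝ, E) (fun q => g q (frameField p u q) (frameField p w q)) p v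
          - mvfderiv 𝓘(ℝ, E) (fun q => g q (frameField p u q) (frameField p v q)) p w)
      map_add' := fun a b => by
        simp only [frameField_add, map_add]
        rw [mvfderiv_fun_add (hg v a) (hg v b), mvfderiv_fun_add (hg u a) (hg u b)]
        simp only [add_apply]
        ring
      map_smul' := fun c a => by
        simp only [frameField_smul, map_smul, smul_eq_mul]
        rw [mvfderiv_fun_mul mdifferentiableAt_const (hg v a),
          mvfderiv_fun_mul mdifferentiableAt_const (hg u a), mvfderiv_const]
        simp
        ring }
  rw [christoffel_eq]
  exact sharp_spec (g p) hnd ℓ w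

theorem christoffel_symm (hs : ∀ q u v, g q u v = g q v u) (u v : TangentSpace 𝓘(ℝ, E) p) :
    christoffel g p u v = christoffel g p v u := by
  rw [christoffel_eq, christoffel_eq]
  congr 1
  ext w
  have : (fun q => g q (frameField p u q) (frameField p v q))
      = fun q => g q (frameField p v q) (frameField p u q) := by
    ext q
    exact hs _ _ _
  rw [this]
  ring

/-- In the sum of the two Koszul formulas the derivatives in the directions `u` and `v` cancel, and
the two derivatives in the direction `a` are equal by symmetry of `g`. -/
theorem christoffel_metric [FiniteDimensional ℝ E] (hg : HasDiffComponentsAt g p)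
    (hs : ∀ q u v, g q u v = g q v u)
    (hnd : ∀ u, (∀ v, g p u v = 0) → u = 0) (a u v : TangentSpace 𝓘(ℝ, E) p) :
    g p (christoffel g p a u) v + g p u (christoffel g p a v)
      = mvfderiv 𝓘(ℝ, E) (fun q => g q (frameField p u q) (frameField p v q)) p a := by
  rw [hs p u, christoffel_spec hg hnd, christoffel_spec hg hnd]
  have : (fun q => g q (frameField p u q) (frameField p v q))
      = fun q => g q (frameField p v q) (frameField p u q) := by
    ext q
    exact hs _ _ _
  rw [this]
  ring

omit [IsManifold 𝓘(ℝ, E) ∞ M] in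
theorem eq_of_forall_metric (hnd : ∀ u, (∀ v, g p u v = 0) → u = 0)
    {u v : TangentSpace 𝓘(ℝ, E) p} (h : ∀ w, g p u w = g p v w) : u = v := by
  rw [← sub_eq_zero]
  refine hnd _ fun w => ?_
  rw [map_sub, sub_apply, h w, sub_self]

theorem christoffel_add_right [FiniteDimensional ℝ E] (hg : HasDiffComponentsAt g p)
    (hnd : ∀ u, (∀ v, g p u v = 0) → u = 0) (u v v' : TangentSpace 𝓘(ℝ, E) p) :
    christoffel g p u (v + v') = christoffel g p u v + christoffel g p u v' := by
  refine eq_of_forall_metric hnd fun w => ?_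
  rw [map_add, add_apply, christoffel_spec hg hnd, christoffel_spec hg hnd,
    christoffel_spec hg hnd]
  simp only [frameField_add, map_add, add_apply]
  rw [mvfderiv_fun_add (hg v w) (hg v' w), mvfderiv_fun_add (hg u v) (hg u v')]
  simp only [add_apply]
  ring

theorem christoffel_smul_right [FiniteDimensional ℝ E] (hg : HasDiffComponentsAt g p)
    (hnd : ∀ u, (∀ v, g p u v = 0) → u = 0) (c : ℝ) (u v : TangentSpace 𝓘(ℝ, E) p) :
    christoffel g p u (c • v) = c • christoffel g p u v := by
  refine eq_of_forall_metric hnd fun w => ?_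
  rw [map_smul, smul_apply, christoffel_spec hg hnd, christoffel_spec hg hnd]
  simp only [frameField_smul, map_smul, smul_apply, smul_eq_mul]
  rw [mvfderiv_fun_mul mdifferentiableAt_const (hg v w),
    mvfderiv_fun_mul mdifferentiableAt_const (hg u v), mvfderiv_const]
  simp
  ring

end Christoffel

variable [FiniteDimensional ℝ E]

theorem covDerivAlong_add (hφ : ContinuousAt φ x) (hg : HasDiffComponentsAt g (φ x))
    (hnd : ∀ u, (∀ v, g (φ x) u v = 0) → u = 0)
    {V W : ∀ x : N, TangentSpace 𝓘(ℝ, E) (φ x)} (hV : DiffAlong E F φ V x) (hW : DiffAlong E F φ W x)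
    (v : TangentSpace 𝓘(ℝ, F) x) :
    covDerivAlong g φ (fun y => V y + W y) x v
      = covDerivAlong g φ V x v + covDerivAlong g φ W x v := by
  rw [covDerivAlong_eq g hφ, covDerivAlong_eq g hφ, covDerivAlong_eq g hφ,
    christoffel_add_right hg hnd]
  simp only [map_add]
  rw [mvfderiv_fun_add hV hW, add_apply, map_add]
  exact add_add_add_comm _ _ _ _

theorem covDerivAlong_smul (hφ : ContinuousAt φ x) (hg : HasDiffComponentsAt g (φ x))
    (hnd : ∀ u, (∀ v, g (φ x) u v = 0) → u = 0)
    {c : N → ℝ} (hc : MDifferentiableAt 𝓘(ℝ, F) 𝓘(ℝ, ℝ) c x)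
    {V : ∀ x : N, TangentSpace 𝓘(ℝ, E) (φ x)} (hV : DiffAlong E F φ V x)
    (v : TangentSpace 𝓘(ℝ, F) x) :
    covDerivAlong g φ (fun y => c y • V y) x v
      = mvfderiv 𝓘(ℝ, F) c x v • V x + c x • covDerivAlong g φ V x v := by
  rw [covDerivAlong_eq g hφ, covDerivAlong_eq g hφ, christoffel_smul_right hg hnd]
  simp only [map_smul]
  rw [mvfderiv_fun_smul hc hV, add_apply, smul_apply, ContinuousLinearMap.smulRight_apply,
    map_add, map_smul, map_smul, frameMap_coordMap_self, smul_add]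
  abel

omit [FiniteDimensional ℝ E] in
theorem covDerivAlong_frameField (hφ : ContinuousAt φ x) (u : TangentSpace 𝓘(ℝ, E) (φ x))
    (v : TangentSpace 𝓘(ℝ, F) x) :
    covDerivAlong g φ (fun y => frameField (φ x) u (φ y)) x v
      = christoffel g (φ x) (mfderiv 𝓘(ℝ, F) 𝓘(ℝ, E) φ x v) u := by
  have h : (fun y => coordMap (φ x) (φ y) (frameField (φ x) u (φ y))) =ᶠ[𝓝 x]
      fun _ => coordMap (φ x) (φ x) u := by
    filter_upwards [eventually_mem_baseSet_comp E hφ] with y hy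
    rw [frameField_eq, coordMap_frameMap hy]
  rw [covDerivAlong_eq g hφ, frameField_self,
    h.mvfderiv_eq, mvfderiv_const, zero_apply, map_zero, zero_add]

/-- Near `x`, a differentiable vector field along `φ` is a combination of coordinate fields. -/
theorem along_induction (hφ : ContinuousAt φ x)
    {P : (∀ x : N, TangentSpace 𝓘(ℝ, E) (φ x)) → Prop}
    (congr : ∀ V W, (∀ᶠ y in 𝓝 x, W y = V y) → P V → P W)
    (zero : P fun _ => 0)
    (add : ∀ V W, DiffAlong E F φ V x → DiffAlong E F φ W x → P V → P W → P fun y => V y + W y)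
    (smul : ∀ (c : N → ℝ) (u : TangentSpace 𝓘(ℝ, E) (φ x)),
      MDifferentiableAt 𝓘(ℝ, F) 𝓘(ℝ, ℝ) c x → P fun y => c y • frameField (φ x) u (φ y))
    {V : ∀ x : N, TangentSpace 𝓘(ℝ, E) (φ x)} (hV : DiffAlong E F φ V x) : P V := by
  let b := Module.finBasis ℝ E
  let c := fun i y => b.coord i (coordMap (φ x) (φ y) (V y))
  have hc : ∀ i, MDifferentiableAt 𝓘(ℝ, F) 𝓘(ℝ, ℝ) (c i) x := fun i =>
    ((LinearMap.toContinuousLinearMap (b.coord i)).differentiableAt.mdifferentiableAt).comp x hV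
  have key : ∀ s : Finset (Fin (Module.finrank ℝ E)),
      DiffAlong E F φ (fun y => ∑ i ∈ s, c i y • frameField (φ x) (frameMap (φ x) (φ x) (b i)) (φ y)) x ∧
      P fun y => ∑ i ∈ s, c i y • frameField (φ x) (frameMap (φ x) (φ x) (b i)) (φ y) := by
    intro s
    induction s using Finset.induction_on with
    | empty =>
      simp only [Finset.sum_empty]
      refine ⟨?_, zero⟩
      simp only [DiffAlong, map_zero]
      exact mdifferentiableAt_const
    | insert i s hi ih =>
      simp only [Finset.sum_insert hi]
      have h := DiffAlong.smul (hc i) (diffAlong_frameField hφ (frameMap (φ x) (φ x) (b i)))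
      exact ⟨h.add ih.1, add _ _ h ih.1 (smul _ _ (hc i)) ih.2⟩
  refine congr _ _ ?_ (key Finset.univ).2
  filter_upwards [eventually_mem_baseSet_comp E hφ] with y hy
  simp only [frameField_frameMap]
  conv_lhs => rw [← frameMap_coordMap hy (V y), ← b.sum_repr (coordMap (φ x) (φ y) (V y)), map_sum]
  exact Finset.sum_congr rfl fun i _ => map_smul _ _ _

/-- The Levi-Civita connection is metric. -/
theorem covDerivAlong_metric (hφ : MDifferentiableAt 𝓘(ℝ, F) 𝓘(ℝ, E) φ x)
    (hg : HasDiffComponentsAt g (φ x))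
    (hs : ∀ q u v, g q u v = g q v u)
    (hnd : ∀ u, (∀ v, g (φ x) u v = 0) → u = 0)
    {V W : ∀ x : N, TangentSpace 𝓘(ℝ, E) (φ x)} (hV : DiffAlong E F φ V x) (hW : DiffAlong E F φ W x)
    (v : TangentSpace 𝓘(ℝ, F) x) :
    MDifferentiableAt 𝓘(ℝ, F) 𝓘(ℝ, ℝ) (fun y => g (φ y) (V y) (W y)) x ∧
    mvfderiv 𝓘(ℝ, F) (fun y => g (φ y) (V y) (W y)) x v
      = g (φ x) (covDerivAlong g φ V x v) (W x) + g (φ x) (V x) (covDerivAlong g φ W x v) := by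
  have hc := hφ.continuousAt
  have base : ∀ u w : TangentSpace 𝓘(ℝ, E) (φ x),
      MDifferentiableAt 𝓘(ℝ, F) 𝓘(ℝ, ℝ) (fun y =>
        g (φ y) (frameField (φ x) u (φ y)) (frameField (φ x) w (φ y))) x ∧
      mvfderiv 𝓘(ℝ, F) (fun y =>
        g (φ y) (frameField (φ x) u (φ y)) (frameField (φ x) w (φ y))) x v
        = g (φ x) (covDerivAlong g φ (fun y => frameField (φ x) u (φ y)) x v) w
          + g (φ x) u (covDerivAlong g φ (fun y => frameField (φ x) w (φ y)) x v) := by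
    intro u w
    refine ⟨(hg u w).comp x hφ, ?_⟩
    rw [covDerivAlong_frameField hc, covDerivAlong_frameField hc, christoffel_metric hg hs hnd]
    exact mvfderiv_comp_apply (g := fun q => g q (frameField (φ x) u q) (frameField (φ x) w q))
      x (hg u w) hφ v
  -- Reduction of the first argument to coordinate fields, with the second one fixed. It is used
  -- twice: with a coordinate field as second argument, and then, by symmetry of `g`, with `W`.
  have step : ∀ Z : ∀ x : N, TangentSpace 𝓘(ℝ, E) (φ x), DiffAlong E F φ Z x →
      (∀ w, MDifferentiableAt 𝓘(ℝ, F) 𝓘(ℝ, ℝ)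
          (fun y => g (φ y) (frameField (φ x) w (φ y)) (Z y)) x ∧
        mvfderiv 𝓘(ℝ, F) (fun y => g (φ y) (frameField (φ x) w (φ y)) (Z y)) x v
          = g (φ x) (covDerivAlong g φ (fun y => frameField (φ x) w (φ y)) x v) (Z x)
            + g (φ x) w (covDerivAlong g φ Z x v)) →
      ∀ V : ∀ x : N, TangentSpace 𝓘(ℝ, E) (φ x), DiffAlong E F φ V x →
      MDifferentiableAt 𝓘(ℝ, F) 𝓘(ℝ, ℝ) (fun y => g (φ y) (V y) (Z y)) x ∧
      mvfderiv 𝓘(ℝ, F) (fun y => g (φ y) (V y) (Z y)) x v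
        = g (φ x) (covDerivAlong g φ V x v) (Z x) + g (φ x) (V x) (covDerivAlong g φ Z x v) := by
    intro Z hZ hb V hV
    refine along_induction (P := fun V =>
      MDifferentiableAt 𝓘(ℝ, F) 𝓘(ℝ, ℝ) (fun y => g (φ y) (V y) (Z y)) x ∧
      mvfderiv 𝓘(ℝ, F) (fun y => g (φ y) (V y) (Z y)) x v
        = g (φ x) (covDerivAlong g φ V x v) (Z x) + g (φ x) (V x) (covDerivAlong g φ Z x v))
      hc ?_ ?_ ?_ ?_ hV
    · intro V V' h hP
      have h' : (fun y => g (φ y) (V' y) (Z y)) =ᶠ[𝓝 x] fun y => g (φ y) (V y) (Z y) := by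
        filter_upwards [h] with y hy
        rw [hy]
      refine ⟨hP.1.congr_of_eventuallyEq h', ?_⟩
      rw [covDerivAlong_congr g hc h, h.self_of_nhds, ← hP.2,
        h'.mvfderiv_eq]
    -- The zero field is `0 • V`, so the Leibniz rule applies.
    · have h0 : covDerivAlong g φ (fun _ => 0) x v = 0 := by
        have h := covDerivAlong_smul hc hg hnd (mdifferentiableAt_const (c := (0 : ℝ))) hV v
        simpa only [zero_smul, mvfderiv_const, zero_apply, add_zero] using h
      simp only [h0, map_zero, zero_apply, mvfderiv_const, add_zero]
      exact ⟨mdifferentiableAt_const, trivial⟩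
    · intro V V' hV hV' hP hP'
      simp only [map_add, add_apply]
      refine ⟨hP.1.add hP'.1, ?_⟩
      rw [mvfderiv_fun_add hP.1 hP'.1, add_apply, hP.2, hP'.2,
        covDerivAlong_add hc hg hnd hV hV', map_add, add_apply]
      ring
    · intro c u hcd
      simp only [map_smul, smul_apply, smul_eq_mul]
      refine ⟨hcd.mul (hb u).1, ?_⟩
      rw [mvfderiv_fun_mul hcd (hb u).1, add_apply, smul_apply, smul_apply, (hb u).2,
        covDerivAlong_smul hc hg hnd hcd (diffAlong_frameField hc u), map_add, map_smul, map_smul,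
        add_apply, smul_apply, smul_apply, frameField_self]
      simp only [smul_eq_mul]
      ring
  refine step W hW (fun w => ?_) V hV
  have hw := diffAlong_frameField (F := F) hc w
  have h := step (fun y => frameField (φ x) w (φ y)) hw
    (fun u => by simpa only [frameField_self] using base u w) W hW
  have e : (fun y => g (φ y) (frameField (φ x) w (φ y)) (W y))
      = fun y => g (φ y) (W y) (frameField (φ x) w (φ y)) := by
    ext y
    exact hs _ _ _
  rw [e]
  refine ⟨h.1, h.2.trans ?_⟩
  rw [frameField_self, hs _ w, hs _ (W x), add_comm]

end Along

end Connection

/-! ### The Lie bracket as a commutator of derivations, and absence of torsion along a map. -/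

section Torsion

variable {E : Type*} [NormedAddCommGroup E] [NormedSpace ℝ E]
  {M : Type*} [TopologicalSpace M] [ChartedSpace E M] [IsManifold 𝓘(ℝ, E) ∞ M]
  {F : Type*} [NormedAddCommGroup F] [NormedSpace ℝ F]
  {N : Type*} [TopologicalSpace N] [ChartedSpace F N] [IsManifold 𝓘(ℝ, F) ∞ N]

/-- The representative of a vector field in the chart at `x`. -/
def chartField (x : N) (X : ∀ y : N, TangentSpace 𝓘(ℝ, F) y) (e : F) : F :=
  VectorField.mpullbackWithin 𝓘(ℝ, F) 𝓘(ℝ, F) (extChartAt 𝓘(ℝ, F) x).symm X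
    (range 𝓘(ℝ, F)) e

/-- The chain rule: the inverse differential in the definition of the pulled back field cancels
against the differential of the inverse chart. -/
theorem mvfderiv_extChartAt_symm {G : Type*} [NormedAddCommGroup G] [NormedSpace ℝ G]
    {x : N} {X : ∀ y : N, TangentSpace 𝓘(ℝ, F) y} {e : F}
    (he : e ∈ (extChartAt 𝓘(ℝ, F) x).target) {k : N → G}
    (hk : MDifferentiableAt 𝓘(ℝ, F) 𝓘(ℝ, G) k ((extChartAt 𝓘(ℝ, F) x).symm e)) :
    fderiv ℝ (k ∘ (extChartAt 𝓘(ℝ, F) x).symm) e (chartField x X e)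
      = mvfderiv 𝓘(ℝ, F) k ((extChartAt 𝓘(ℝ, F) x).symm e)
          (X ((extChartAt 𝓘(ℝ, F) x).symm e)) := by
  have hs := mdifferentiableWithinAt_extChartAt_symm he
  have hi := isInvertible_mfderivWithin_extChartAt_symm he
  rw [chartField, VectorField.mpullbackWithin_apply]
  obtain ⟨A, hA⟩ := hi
  rw [← hA]
  have hr : range 𝓘(ℝ, F) = univ := by simp
  rw [hr] at hs hA
  rw [mdifferentiableWithinAt_univ] at hs
  rw [mfderivWithin_univ] at hA
  have h := mfderiv_comp_apply e hk hs
    ((A : TangentSpace 𝓘(ℝ, F) e →L[ℝ] _).inverse (X ((extChartAt 𝓘(ℝ, F) x).symm e)))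
  rw [mfderiv_eq_fderiv] at h
  refine h.trans ?_
  rw [← hA, ContinuousLinearMap.inverse_equiv]
  have : (A : TangentSpace 𝓘(ℝ, F) e →L[ℝ] _)
    ((A.symm : _ →L[ℝ] TangentSpace 𝓘(ℝ, F) e) (X ((extChartAt 𝓘(ℝ, F) x).symm e)))
     = X ((extChartAt 𝓘(ℝ, F) x).symm e) := A.apply_symm_apply _
  rw [this]
  rfl

/-- In the chart at `x`, `X(Y h) - Y(X h)` has two kinds of terms: the second derivatives of `h`,
which cancel by symmetry, and the first derivative of `h` on the bracket of the representatives. The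
vector-valued case is needed, with `h` a chart of `M` composed with `f`. -/
theorem mvfderiv_mlieBracket [FiniteDimensional ℝ F]
    {G : Type*} [NormedAddCommGroup G] [NormedSpace ℝ G] {x : N} {h : N → G}
    (hh : ContMDiffAt 𝓘(ℝ, F) 𝓘(ℝ, G) 2 h x) {X Y : ∀ y : N, TangentSpace 𝓘(ℝ, F) y}
    (hX : MDifferentiableAt 𝓘(ℝ, F) 𝓘(ℝ, F).tangent
      (fun y => (TotalSpace.mk' F y (X y) : TangentBundle 𝓘(ℝ, F) N)) x)
    (hY : MDifferentiableAt 𝓘(ℝ, F) 𝓘(ℝ, F).tangent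
      (fun y => (TotalSpace.mk' F y (Y y) : TangentBundle 𝓘(ℝ, F) N)) x) :
    mvfderiv 𝓘(ℝ, F) h x (VectorField.mlieBracket 𝓘(ℝ, F) X Y x)
      = mvfderiv 𝓘(ℝ, F) (fun y => mvfderiv 𝓘(ℝ, F) h y (Y y)) x (X x)
        - mvfderiv 𝓘(ℝ, F) (fun y => mvfderiv 𝓘(ℝ, F) h y (X y)) x (Y x) := by
  have : CompleteSpace F := FiniteDimensional.complete ℝ F
  have : IsManifold 𝓘(ℝ, F) 2 N := .of_le (n := ∞) (WithTop.coe_le_coe.2 le_top)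
  set ψ := extChartAt 𝓘(ℝ, F) x with hψ
  have hxt : ψ x ∈ ψ.target := mem_extChartAt_target x
  have hinv : ψ.symm (ψ x) = x := extChartAt_to_inv x
  set H : F → G := h ∘ ψ.symm with hH
  have hHc : ContDiffAt ℝ 2 H (ψ x) := by
    have := (contMDiffAt_iff.1 hh).2
    rwa [ModelWithCorners.range_eq_univ, contDiffWithinAt_univ, extChartAt_model_space_eq_id] at this
  have htn : ∀ᶠ e in 𝓝 (ψ x), e ∈ ψ.target := by
    have := extChartAt_target_mem_nhds (I := 𝓘(ℝ, F)) x
    exact this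
  have hsc : ContinuousAt ψ.symm (ψ x) := continuousAt_extChartAt_symm x
  have hd : ∀ᶠ y in 𝓝 x, MDifferentiableAt 𝓘(ℝ, F) 𝓘(ℝ, G) h y := by
    filter_upwards [(contMDiffAt_iff_contMDiffAt_nhds (by simp)).1 hh] with y hy
    exact hy.mdifferentiableAt (by simp)
  have hdc : ∀ Z : ∀ y : N, TangentSpace 𝓘(ℝ, F) y, MDifferentiableAt 𝓘(ℝ, F) 𝓘(ℝ, F).tangent
      (fun y => (TotalSpace.mk' F y (Z y) : TangentBundle 𝓘(ℝ, F) N)) x →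
      DifferentiableAt ℝ (chartField x Z) (ψ x) := by
    intro Z hZ
    rw [← mdifferentiableWithinAt_univ] at hZ
    have := hZ.differentiableWithinAt_mpullbackWithin_vectorField
    have h' : DifferentiableWithinAt ℝ (chartField x Z) _ (ψ x) := this
    rwa [preimage_univ, univ_inter, ModelWithCorners.range_eq_univ,
      differentiableWithinAt_univ] at h'
  have hcomp : ∀ Z : ∀ y : N, TangentSpace 𝓘(ℝ, F) y,
      (fun y => mvfderiv 𝓘(ℝ, F) h y (Z y)) ∘ ψ.symm
        =ᶠ[𝓝 (ψ x)] fun e => fderiv ℝ H e (chartField x Z e) := by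
    intro Z
    filter_upwards [htn, hsc.eventually (hinv.symm ▸ hd)] with e he hde
    exact (mvfderiv_extChartAt_symm he hde).symm
  have key : ∀ Z W : ∀ y : N, TangentSpace 𝓘(ℝ, F) y, MDifferentiableAt 𝓘(ℝ, F) 𝓘(ℝ, F).tangent
      (fun y => (TotalSpace.mk' F y (Z y) : TangentBundle 𝓘(ℝ, F) N)) x →
      mvfderiv 𝓘(ℝ, F) (fun y => mvfderiv 𝓘(ℝ, F) h y (Z y)) x (W x)
        = fderiv ℝ (fderiv ℝ H) (ψ x) (chartField x W (ψ x)) (chartField x Z (ψ x))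
          + fderiv ℝ H (ψ x) (fderiv ℝ (chartField x Z) (ψ x) (chartField x W (ψ x))) := by
    intro Z W hZ
    have hd2 : DifferentiableAt ℝ (fderiv ℝ H) (ψ x) :=
      (hHc.fderiv_right (m := 1) (by norm_num)).differentiableAt (by simp)
    have hK : DifferentiableAt ℝ (fun e => fderiv ℝ H e (chartField x Z e)) (ψ x) :=
      hd2.clm_apply (hdc Z hZ)
    have hk : MDifferentiableAt 𝓘(ℝ, F) 𝓘(ℝ, G) (fun y => mvfderiv 𝓘(ℝ, F) h y (Z y)) x := by
      have h1 : MDifferentiableAt 𝓘(ℝ, F) 𝓘(ℝ, G)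
          ((fun e => fderiv ℝ H e (chartField x Z e)) ∘ ψ) x :=
        hK.mdifferentiableAt.comp x (mdifferentiableAt_extChartAt (mem_chart_source F x))
      refine h1.congr_of_eventuallyEq ?_
      have h2 := (continuousAt_extChartAt (I := 𝓘(ℝ, F)) x).eventually (hcomp Z)
      filter_upwards [h2, extChartAt_source_mem_nhds (I := 𝓘(ℝ, F)) x] with y hy hys
      have := ψ.left_inv hys
      simp only [Function.comp_apply] at hy ⊢
      rw [← hy, this]
    have h1 := mvfderiv_extChartAt_symm (X := W) hxt (k := fun y => mvfderiv 𝓘(ℝ, F) h y (Z y))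
      (hinv.symm ▸ hk)
    -- The point `ψ.symm (ψ x)` equals `x` only propositionally, and the tangent spaces depend on
    -- it, so the equality is transported through a variable `z`.
    have h2 : ∀ z, z = x → mvfderiv 𝓘(ℝ, F) (fun y => mvfderiv 𝓘(ℝ, F) h y (Z y)) z (W z)
        = mvfderiv 𝓘(ℝ, F) (fun y => mvfderiv 𝓘(ℝ, F) h y (Z y)) x (W x) := by
      rintro z rfl
      rfl
    rw [h2 _ hinv, (hcomp Z).fderiv_eq, fderiv_clm_apply hd2 (hdc Z hZ)] at h1
    rw [← h1]
    simp [add_comm]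
  rw [key Y X hY, key X Y hX]
  have hsymm := hHc.isSymmSndFDerivAt (by simp)
  have hh' : h =ᶠ[𝓝 x] H ∘ ψ := by
    filter_upwards [extChartAt_source_mem_nhds (I := 𝓘(ℝ, F)) x] with y hys
    exact congrArg h (ψ.left_inv hys).symm
  have hψd : MDifferentiableAt 𝓘(ℝ, F) 𝓘(ℝ, F) ψ x :=
    mdifferentiableAt_extChartAt (mem_chart_source F x)
  have hHd : DifferentiableAt ℝ H (ψ x) := hHc.differentiableAt (by simp)
  have h3 : mvfderiv 𝓘(ℝ, F) h x (VectorField.mlieBracket 𝓘(ℝ, F) X Y x)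
      = fderiv ℝ H (ψ x) (VectorField.lieBracket ℝ (chartField x X) (chartField x Y) (ψ x)) := by
    rw [hh'.mvfderiv_eq, ← VectorField.mlieBracketWithin_univ,
      VectorField.mlieBracketWithin_apply]
    obtain ⟨A, hA⟩ := isInvertible_mfderiv_extChartAt (I := 𝓘(ℝ, F)) (mem_extChartAt_source x)
    have h4 := mfderiv_comp_apply x hHd.mdifferentiableAt hψd
    refine (h4 _).trans ?_
    rw [mfderiv_eq_fderiv]
    have h5 : VectorField.lieBracketWithin ℝ (chartField x X) (chartField x Y)
        ((extChartAt 𝓘(ℝ, F) x).symm ⁻¹' univ ∩ range 𝓘(ℝ, F)) (ψ x)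
        = VectorField.lieBracket ℝ (chartField x X) (chartField x Y) (ψ x) := by
      rw [preimage_univ, univ_inter, ModelWithCorners.range_eq_univ,
        VectorField.lieBracketWithin_univ]
    rw [← h5, hψ, ← hA, ContinuousLinearMap.inverse_equiv]
    exact congrArg _ (A.apply_symm_apply _)
  rw [h3, VectorField.lieBracket, map_sub, hsymm (chartField x X (ψ x))]
  abel

variable {f : N → M}

theorem coordMap_mfderiv {p q : M} (hq : q ∈ (chartAt E p).source) :
    coordMap p q = mvfderiv 𝓘(ℝ, E) (extChartAt 𝓘(ℝ, E) p) q := by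
  rw [coordMap, TangentBundle.continuousLinearMapAt_trivializationAt hq]
  rfl

/-- The components of the image of `Y` are the derivatives along `Y` of the chart of `M` composed
with `f`. The difference is then the bracket formula for this function, since the Christoffel terms
cancel by symmetry. -/
theorem covDerivAlong_torsion [FiniteDimensional ℝ F]
    {g : ∀ p : M, TangentSpace 𝓘(ℝ, E) p →L[ℝ] TangentSpace 𝓘(ℝ, E) p →L[ℝ] ℝ}
    (hs : ∀ q u v, g q u v = g q v u) {x : N}
    (hf : ContMDiff 𝓘(ℝ, F) 𝓘(ℝ, E) ∞ f) {X Y : ∀ y : N, TangentSpace 𝓘(ℝ, F) y}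
    (hX : MDifferentiableAt 𝓘(ℝ, F) 𝓘(ℝ, F).tangent
      (fun y => (TotalSpace.mk' F y (X y) : TangentBundle 𝓘(ℝ, F) N)) x)
    (hY : MDifferentiableAt 𝓘(ℝ, F) 𝓘(ℝ, F).tangent
      (fun y => (TotalSpace.mk' F y (Y y) : TangentBundle 𝓘(ℝ, F) N)) x) :
    covDerivAlong g f (fun y => mfderiv 𝓘(ℝ, F) 𝓘(ℝ, E) f y (Y y)) x (X x)
      - covDerivAlong g f (fun y => mfderiv 𝓘(ℝ, F) 𝓘(ℝ, E) f y (X y)) x (Y x)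
      = mfderiv 𝓘(ℝ, F) 𝓘(ℝ, E) f x (VectorField.mlieBracket 𝓘(ℝ, F) X Y x) := by
  have hc : ContinuousAt f x := hf.continuous.continuousAt
  have hsrc : ∀ᶠ y in 𝓝 x, f y ∈ (chartAt E (f x)).source :=
    hc.eventually ((chartAt E (f x)).open_source.mem_nhds (mem_chart_source E (f x)))
  have hcomp : ∀ y, f y ∈ (chartAt E (f x)).source → ∀ v : TangentSpace 𝓘(ℝ, F) y,
      coordMap (f x) (f y) (mfderiv 𝓘(ℝ, F) 𝓘(ℝ, E) f y v)
        = mvfderiv 𝓘(ℝ, F) (extChartAt 𝓘(ℝ, E) (f x) ∘ f) y v := by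
    intro y hy v
    rw [coordMap_mfderiv hy]
    exact (mfderiv_comp_apply y (mdifferentiableAt_extChartAt hy)
      (hf.mdifferentiable (by simp) y) v).symm
  have he : ∀ Z : ∀ y : N, TangentSpace 𝓘(ℝ, F) y,
      (fun y => coordMap (f x) (f y) (mfderiv 𝓘(ℝ, F) 𝓘(ℝ, E) f y (Z y))) =ᶠ[𝓝 x]
        fun y => mvfderiv 𝓘(ℝ, F) (extChartAt 𝓘(ℝ, E) (f x) ∘ f) y (Z y) := by
    intro Z
    filter_upwards [hsrc] with y hy
    exact hcomp y hy _
  have hh : ContMDiffAt 𝓘(ℝ, F) 𝓘(ℝ, E) 2 (extChartAt 𝓘(ℝ, E) (f x) ∘ f) x := by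
    have h1 : ContMDiffAt 𝓘(ℝ, F) 𝓘(ℝ, E) ∞ (extChartAt 𝓘(ℝ, E) (f x) ∘ f) x :=
      (contMDiffAt_extChartAt' (mem_chart_source E (f x))).comp x (hf x)
    exact h1.of_le (WithTop.coe_le_coe.2 le_top)
  rw [covDerivAlong_eq g hc, covDerivAlong_eq g hc, (he X).mvfderiv_eq, (he Y).mvfderiv_eq,
    christoffel_symm hs, add_sub_add_right_eq_sub, ← map_sub, ← mvfderiv_mlieBracket hh hX hY,
    ← hcomp x (mem_chart_source E (f x)), frameMap_coordMap_self]

end Torsion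

/-! ### Smooth fields along a map, the Gauss formula, and parallel endomorphisms along a map. -/

section Gauss

variable {E : Type*} [NormedAddCommGroup E] [NormedSpace ℝ E]
  {M : Type*} [TopologicalSpace M] [ChartedSpace E M] [IsManifold 𝓘(ℝ, E) ∞ M]
  {F : Type*} [NormedAddCommGroup F] [NormedSpace ℝ F]
  {N : Type*} [TopologicalSpace N] [ChartedSpace F N] [IsManifold 𝓘(ℝ, F) ∞ N]

variable (E F) in
/-- The vector field `V` along `f` is smooth at `x`. -/
def SmoothAlongAt (f : N → M) (V : ∀ x : N, TangentSpace 𝓘(ℝ, E) (f x)) (x : N) : Prop :=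
  ContMDiffAt 𝓘(ℝ, F) 𝓘(ℝ, E).tangent ∞
    (fun y => (TotalSpace.mk' E (f y) (V y) : TangentBundle 𝓘(ℝ, E) M)) x

variable (F) in
/-- The vector field `X` is smooth at `x`. -/
def SmoothFieldAt (X : ∀ x : N, TangentSpace 𝓘(ℝ, F) x) (x : N) : Prop :=
  SmoothAlongAt F F (fun y : N => y) X x

theorem smoothFieldAt_frameMap {x y : N}
    (hy : y ∈ (trivializationAt F (TangentSpace 𝓘(ℝ, F) : N → Type _) x).baseSet)
    {c : N → F} (hc : ContMDiffAt 𝓘(ℝ, F) 𝓘(ℝ, F) ∞ c y) :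
    SmoothFieldAt F (fun z => frameMap x z (c z)) y := by
  have h := (trivializationAt F (TangentSpace 𝓘(ℝ, F) : N → Type _) x).contMDiffAt_iff
    (IB := 𝓘(ℝ, F)) (IM := 𝓘(ℝ, F)) (n := ∞) (f := fun z : N =>
      (TotalSpace.mk' F z (frameMap x z (c z)) : TangentBundle 𝓘(ℝ, F) N)) (x₀ := y)
      (by rw [Trivialization.mem_source]; exact hy)
  refine h.2 ⟨contMDiffAt_id, ?_⟩
  refine hc.congr_of_eventuallyEq ?_
  filter_upwards [(trivializationAt F (TangentSpace 𝓘(ℝ, F) : N → Type _)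
    x).open_baseSet.mem_nhds hy] with z hz
  rw [coordMap_apply hz, coordMap_frameMap hz]

theorem smoothFieldAt_frameField_self (x : N) (v : TangentSpace 𝓘(ℝ, F) x) :
    SmoothFieldAt F (frameField x v) x :=
  smoothFieldAt_frameMap (FiberBundle.mem_baseSet_trivializationAt' x) contMDiffAt_const

variable {f : N → M} {x : N}

theorem SmoothFieldAt.mdifferentiableAt {X : ∀ x : N, TangentSpace 𝓘(ℝ, F) x}
    (hX : SmoothFieldAt F X x) : MDifferentiableAt 𝓘(ℝ, F) 𝓘(ℝ, F).tangent
      (fun y => (TotalSpace.mk' F y (X y) : TangentBundle 𝓘(ℝ, F) N)) x :=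
  ContMDiffAt.mdifferentiableAt hX (by simp)

theorem SmoothFieldAt.mfderiv (hf : ContMDiff 𝓘(ℝ, F) 𝓘(ℝ, E) ∞ f)
    {X : ∀ x : N, TangentSpace 𝓘(ℝ, F) x} (hX : SmoothFieldAt F X x) :
    SmoothAlongAt E F f (fun y => mfderiv 𝓘(ℝ, F) 𝓘(ℝ, E) f y (X y)) x := by
  have h := hf.contMDiff_tangentMap (m := ∞) (by simp)
  exact ContMDiffAt.comp x (h.contMDiffAt) hX

variable {g : ∀ p : M, TangentSpace 𝓘(ℝ, E) p →L[ℝ] TangentSpace 𝓘(ℝ, E) p →L[ℝ] ℝ}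

omit [IsManifold 𝓘(ℝ, F) ∞ N] in
theorem IsSemiRiemannianMetric.contMDiffAt_apply (hg : IsSemiRiemannianMetric g)
    {V W : ∀ x : N, TangentSpace 𝓘(ℝ, E) (f x)} (hV : SmoothAlongAt E F f V x)
    (hW : SmoothAlongAt E F f W x) :
    ContMDiffAt 𝓘(ℝ, F) 𝓘(ℝ, ℝ) ∞ (fun y => g (f y) (V y) (W y)) x := by
  have hf : ContMDiffAt 𝓘(ℝ, F) 𝓘(ℝ, E) ∞ f x := (contMDiffAt_totalSpace.1 hV).1
  have h := ContMDiffAt.clm_bundle_apply₂ (E₃ := Bundle.Trivial M ℝ) (F₃ := ℝ) (n := ∞)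
    (b := f) (ψ := fun y => g (f y)) (IB := 𝓘(ℝ, E)) (IM := 𝓘(ℝ, F))
    ((hg.contMDiff (f x)).comp x hf) hV hW
  exact (contMDiffAt_totalSpace.1 h).2

theorem IsSemiRiemannianMetric.hasDiffComponentsAt (hg : IsSemiRiemannianMetric g) (p : M) :
    HasDiffComponentsAt g p := fun u v =>
  (hg.contMDiffAt_apply (f := fun q : M => q) (smoothFieldAt_frameField_self p u)
    (smoothFieldAt_frameField_self p v)).mdifferentiableAt (by simp)

omit [IsManifold 𝓘(ℝ, E) ∞ M] [IsManifold 𝓘(ℝ, F) ∞ N] in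
theorem inducedMetric_apply (u v : TangentSpace 𝓘(ℝ, F) x) :
    inducedMetric F g f x u v
      = g (f x) (mfderiv 𝓘(ℝ, F) 𝓘(ℝ, E) f x u) (mfderiv 𝓘(ℝ, F) 𝓘(ℝ, E) f x v) := rfl

omit [IsManifold 𝓘(ℝ, F) ∞ N] in
theorem inducedMetric_symm (hg : IsSemiRiemannianMetric g) (x : N)
    (u v : TangentSpace 𝓘(ℝ, F) x) :
    inducedMetric F g f x u v = inducedMetric F g f x v u :=
  hg.symm _ _ _

theorem inducedMetric_contMDiffAt (hg : IsSemiRiemannianMetric g)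
    (hf : ContMDiff 𝓘(ℝ, F) 𝓘(ℝ, E) ∞ f) {X Y : ∀ x : N, TangentSpace 𝓘(ℝ, F) x}
    (hX : SmoothFieldAt F X x) (hY : SmoothFieldAt F Y x) :
    ContMDiffAt 𝓘(ℝ, F) 𝓘(ℝ, ℝ) ∞ (fun y => inducedMetric F g f y (X y) (Y y)) x :=
  hg.contMDiffAt_apply (hX.mfderiv hf) (hY.mfderiv hf)

theorem inducedMetric_hasDiffComponentsAt (hg : IsSemiRiemannianMetric g)
    (hf : ContMDiff 𝓘(ℝ, F) 𝓘(ℝ, E) ∞ f) (x : N) :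
    HasDiffComponentsAt (inducedMetric F g f) x := fun u v =>
  (inducedMetric_contMDiffAt hg hf (smoothFieldAt_frameField_self x u)
    (smoothFieldAt_frameField_self x v)).mdifferentiableAt (by simp)

theorem leviCivita_torsion [FiniteDimensional ℝ F]
    {h : ∀ x : N, TangentSpace 𝓘(ℝ, F) x →L[ℝ] TangentSpace 𝓘(ℝ, F) x →L[ℝ] ℝ}
    (hs : ∀ q u v, h q u v = h q v u) {X Y : ∀ x : N, TangentSpace 𝓘(ℝ, F) x}
    (hX : SmoothFieldAt F X x) (hY : SmoothFieldAt F Y x) :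
    leviCivita h Y x (X x) - leviCivita h X x (Y x)
      = VectorField.mlieBracket 𝓘(ℝ, F) X Y x := by
  have h := covDerivAlong_torsion (f := fun q : N => q) hs contMDiff_id
    hX.mdifferentiableAt hY.mdifferentiableAt
  have e : ∀ y : N, mfderiv 𝓘(ℝ, F) 𝓘(ℝ, F) (fun q : N => q) y
      = ContinuousLinearMap.id ℝ (TangentSpace 𝓘(ℝ, F) y) := fun y => mfderiv_id
  simp only [e] at h
  exact h

theorem leviCivita_metric [FiniteDimensional ℝ F]
    {h : ∀ x : N, TangentSpace 𝓘(ℝ, F) x →L[ℝ] TangentSpace 𝓘(ℝ, F) x →L[ℝ] ℝ}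
    (hd : HasDiffComponentsAt h x) (hs : ∀ q u v, h q u v = h q v u)
    (hnd : ∀ u, (∀ v, h x u v = 0) → u = 0) {X Y : ∀ x : N, TangentSpace 𝓘(ℝ, F) x}
    (hX : SmoothFieldAt F X x) (hY : SmoothFieldAt F Y x) (v : TangentSpace 𝓘(ℝ, F) x) :
    mvfderiv 𝓘(ℝ, F) (fun y => h y (X y) (Y y)) x v
      = h x (leviCivita h X x v) (Y x) + h x (X x) (leviCivita h Y x v) :=
  (covDerivAlong_metric (φ := fun q : N => q) mdifferentiableAt_id hd hs hnd
    (ContMDiffAt.diffAlong hX) (ContMDiffAt.diffAlong hY) v).2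

omit [IsManifold 𝓘(ℝ, F) ∞ N] in
theorem covDerivAlong_metric_of_smooth [FiniteDimensional ℝ E] (hg : IsSemiRiemannianMetric g)
    {V W : ∀ x : N, TangentSpace 𝓘(ℝ, E) (f x)} (hV : SmoothAlongAt E F f V x)
    (hW : SmoothAlongAt E F f W x) (v : TangentSpace 𝓘(ℝ, F) x) :
    mvfderiv 𝓘(ℝ, F) (fun y => g (f y) (V y) (W y)) x v
      = g (f x) (covDerivAlong g f V x v) (W x) + g (f x) (V x) (covDerivAlong g f W x v) :=
  (covDerivAlong_metric ((contMDiffAt_totalSpace.1 hV).1.mdifferentiableAt (by simp))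
    (hg.hasDiffComponentsAt _) hg.symm (hg.nondegenerate _) (ContMDiffAt.diffAlong hV)
    (ContMDiffAt.diffAlong hW) v).2

omit [IsManifold 𝓘(ℝ, F) ∞ N] in
/-- Differentiating a relation `g(V, W) = 0`. -/
theorem covDerivAlong_orthogonal [FiniteDimensional ℝ E] (hg : IsSemiRiemannianMetric g)
    {V W : ∀ x : N, TangentSpace 𝓘(ℝ, E) (f x)} (hV : SmoothAlongAt E F f V x)
    (hW : SmoothAlongAt E F f W x) (h0 : ∀ᶠ y in 𝓝 x, g (f y) (V y) (W y) = 0)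
    (v : TangentSpace 𝓘(ℝ, F) x) :
    g (f x) (covDerivAlong g f V x v) (W x) = -g (f x) (V x) (covDerivAlong g f W x v) := by
  have h := covDerivAlong_metric_of_smooth hg hV hW v
  have e : (fun y => g (f y) (V y) (W y)) =ᶠ[𝓝 x] fun _ => (0 : ℝ) := h0
  rw [e.mvfderiv_eq, mvfderiv_const, zero_apply] at h
  linarith

/-- The tangential part of the connection of `M` is the Levi-Civita connection of the induced
metric. -/
theorem gauss_formula [FiniteDimensional ℝ E] [FiniteDimensional ℝ F]
    (hg : IsSemiRiemannianMetric g) (hN : IsNondegenerateSubmanifold F g f)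
    {Y : ∀ x : N, TangentSpace 𝓘(ℝ, F) x} (hY : SmoothFieldAt F Y x)
    (v z : TangentSpace 𝓘(ℝ, F) x) :
    g (f x) (covDerivAlong g f (fun y => mfderiv 𝓘(ℝ, F) 𝓘(ℝ, E) f y (Y y)) x v)
        (mfderiv 𝓘(ℝ, F) 𝓘(ℝ, E) f x z)
      = inducedMetric F g f x (leviCivita (inducedMetric F g f) Y x v) z := by
  set h := inducedMetric F g f with hh
  let T : (∀ x : N, TangentSpace 𝓘(ℝ, F) x) → (∀ x : N, TangentSpace 𝓘(ℝ, F) x) →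
      (∀ x : N, TangentSpace 𝓘(ℝ, F) x) → ℝ := fun X Y Z =>
    g (f x) (covDerivAlong g f (fun y => mfderiv 𝓘(ℝ, F) 𝓘(ℝ, E) f y (Y y)) x (X x))
        (mfderiv 𝓘(ℝ, F) 𝓘(ℝ, E) f x (Z x)) - h x (leviCivita h Y x (X x)) (Z x)
  have hT1 : ∀ X Y Z, SmoothFieldAt F X x → SmoothFieldAt F Y x → T X Y Z = T Y X Z := by
    intro X Y Z hX hY
    have h1 := covDerivAlong_torsion (x := x) hg.symm hN.contMDiff hX.mdifferentiableAt
      hY.mdifferentiableAt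
    have h2 := leviCivita_torsion (inducedMetric_symm (f := f) hg) hX hY
    rw [← h2, sub_eq_iff_eq_add] at h1
    simp only [T]
    rw [h1, map_add, add_apply, map_sub, map_sub, sub_apply]
    simp only [hh, inducedMetric_apply]
    ring
  have hT2 : ∀ X Y Z, SmoothFieldAt F Y x → SmoothFieldAt F Z x → T X Y Z = -T X Z Y := by
    intro X Y Z hY hZ
    have h1 := covDerivAlong_metric_of_smooth hg (hY.mfderiv hN.contMDiff)
      (hZ.mfderiv hN.contMDiff) (X x)
    have h2 := leviCivita_metric (inducedMetric_hasDiffComponentsAt hg hN.contMDiff x)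
      (inducedMetric_symm hg) (hN.nondegenerate x) hY hZ (X x)
    simp only [inducedMetric_apply] at h2
    rw [h1] at h2
    simp only [T, hh, inducedMetric_apply]
    rw [hg.symm _ (covDerivAlong g f (fun y => mfderiv 𝓘(ℝ, F) 𝓘(ℝ, E) f y (Z y)) x (X x)),
      hg.symm _ (mfderiv 𝓘(ℝ, F) 𝓘(ℝ, E) f x (leviCivita (inducedMetric F g f) Z x (X x)))]
    linarith
  -- Metricity and absence of torsion concern fields, so `v` and `z` are extended by coordinate
  -- fields.
  have hX := smoothFieldAt_frameField_self x v
  have hZ := smoothFieldAt_frameField_self x z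
  set X := frameField x v with hXd
  set Z := frameField x z with hZd
  -- `T` is symmetric in its first two arguments and skew in its last two. Alternating the two rules
  -- six times returns to `T X Y Z` with the opposite sign.
  have h0 : T X Y Z = 0 := by
    have := hT1 X Y Z hX hY
    have := hT2 Y X Z hX hZ
    have := hT1 Y Z X hY hZ
    have := hT2 Z Y X hY hX
    have := hT1 Z X Y hZ hX
    have := hT2 X Z Y hZ hY
    linarith
  have h1 := sub_eq_zero.1 h0
  simpa only [hXd, hZd, frameField_self] using h1

omit [IsManifold 𝓘(ℝ, F) ∞ N] in
-- Both sides use the chart of `M` at `f x`: the derivative terms agree by the chain rule and the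
-- Christoffel terms coincide.
theorem covDerivAlong_comp (hf : MDifferentiableAt 𝓘(ℝ, F) 𝓘(ℝ, E) f x)
    {Y : ∀ p : M, TangentSpace 𝓘(ℝ, E) p} (hY : SmoothFieldAt E Y (f x))
    (v : TangentSpace 𝓘(ℝ, F) x) :
    covDerivAlong g f (fun y => Y (f y)) x v
      = leviCivita g Y (f x) (mfderiv 𝓘(ℝ, F) 𝓘(ℝ, E) f x v) := by
  rw [leviCivita, covDerivAlong_eq g hf.continuousAt,
    covDerivAlong_eq (φ := fun q : M => q) g continuousAt_id]
  have e : mfderiv 𝓘(ℝ, E) 𝓘(ℝ, E) (fun q : M => q) (f x)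
      = ContinuousLinearMap.id ℝ (TangentSpace 𝓘(ℝ, E) (f x)) := mfderiv_id
  rw [e]
  exact congrArg (frameMap (f x) (f x) · + _)
    (mfderiv_comp_apply x (ContMDiffAt.diffAlong (φ := fun q : M => q) hY) hf v)

omit [IsManifold 𝓘(ℝ, F) ∞ N] in
theorem DiffAlong.comp (hf : MDifferentiableAt 𝓘(ℝ, F) 𝓘(ℝ, E) f x)
    {Y : ∀ p : M, TangentSpace 𝓘(ℝ, E) p} (hY : SmoothFieldAt E Y (f x)) :
    DiffAlong E F f (fun y => Y (f y)) x :=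
  MDifferentiableAt.comp x (ContMDiffAt.diffAlong (φ := fun q : M => q) hY) hf

omit [IsManifold 𝓘(ℝ, F) ∞ N] in
theorem IsSmoothEndOn.smoothAlongAt
    {S : ∀ p : M, TangentSpace 𝓘(ℝ, E) p →L[ℝ] TangentSpace 𝓘(ℝ, E) p} {U : Set M}
    (hU : IsOpen U) (hS : IsSmoothEndOn S U) (hx : f x ∈ U)
    {V : ∀ x : N, TangentSpace 𝓘(ℝ, E) (f x)} (hV : SmoothAlongAt E F f V x) :
    SmoothAlongAt E F f (fun y => S (f y) (V y)) x := by
  have hf : ContMDiffAt 𝓘(ℝ, F) 𝓘(ℝ, E) ∞ f x := (contMDiffAt_totalSpace.1 hV).1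
  exact ContMDiffAt.clm_bundle_apply (n := ∞) (b := f) (ϕ := fun y => S (f y)) (IB := 𝓘(ℝ, E))
    (IM := 𝓘(ℝ, F)) (((hS (f x) hx).contMDiffAt (hU.mem_nhds hx)).comp x hf) hV

omit [IsManifold 𝓘(ℝ, F) ∞ N] in
/-- The covariant derivative, along a map, of a section of a parallel bundle of endomorphisms. -/
theorem IsParaquaternionicKahler.parallel_along [FiniteDimensional ℝ E]
    {σ : ∀ p : M, Submodule ℝ (TangentSpace 𝓘(ℝ, E) p →L[ℝ] TangentSpace 𝓘(ℝ, E) p)}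
    (hM : IsParaquaternionicKahler g σ) {U : Set M}
    {S : ∀ p : M, TangentSpace 𝓘(ℝ, E) p →L[ℝ] TangentSpace 𝓘(ℝ, E) p}
    (hU : IsOpen U) (hS : IsSmoothEndOn S U) (hSσ : ∀ p ∈ U, S p ∈ σ p) (hx : f x ∈ U)
    (hf : MDifferentiableAt 𝓘(ℝ, F) 𝓘(ℝ, E) f x) (v : TangentSpace 𝓘(ℝ, F) x) :
    ∃ T ∈ σ (f x), ∀ V : ∀ x : N, TangentSpace 𝓘(ℝ, E) (f x), DiffAlong E F f V x →
      covDerivAlong g f (fun y => S (f y) (V y)) x v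
        = S (f x) (covDerivAlong g f V x v) + T (V x) := by
  obtain ⟨T, hT, hTY⟩ := hM.parallel U S hU hS hSσ (f x) hx (mfderiv 𝓘(ℝ, F) 𝓘(ℝ, E) f x v)
  refine ⟨T, hT, fun V hV => ?_⟩
  have hc := hf.continuousAt
  have hg := hM.metric.hasDiffComponentsAt (f x)
  have hnd := hM.metric.nondegenerate (f x)
  have hsm : ∀ u, SmoothFieldAt E (fun q => S q (frameField (f x) u q)) (f x) := fun u =>
    IsSmoothEndOn.smoothAlongAt (f := fun q : M => q) hU hS hx (smoothFieldAt_frameField_self _ u)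
  suffices h : DiffAlong E F f (fun y => S (f y) (V y)) x ∧
      covDerivAlong g f (fun y => S (f y) (V y)) x v
        = S (f x) (covDerivAlong g f V x v) + T (V x) from h.2
  -- Parallelism of `σ` is given for fields on `M`, and a field along `f` need not come from one.
  -- Coordinate fields do, and the terms with the derivative of `c` are the same on both sides.
  have hsmul : ∀ (c : N → ℝ) (u : TangentSpace 𝓘(ℝ, E) (f x)),
      MDifferentiableAt 𝓘(ℝ, F) 𝓘(ℝ, ℝ) c x →
      DiffAlong E F f (fun y => S (f y) (c y • frameField (f x) u (f y))) x ∧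
      covDerivAlong g f (fun y => S (f y) (c y • frameField (f x) u (f y))) x v
        = S (f x) (covDerivAlong g f (fun y => c y • frameField (f x) u (f y)) x v)
          + T (c x • frameField (f x) u (f x)) := by
    intro c u hcd
    simp only [map_smul]
    have hd := DiffAlong.comp hf (hsm u)
    refine ⟨hd.smul hcd, ?_⟩
    have hF := smoothFieldAt_frameField_self (f x) u
    have h1 := hTY _ hF
    rw [← covDerivAlong_comp hf hF, ← covDerivAlong_comp hf (hsm u), sub_eq_iff_eq_add] at h1
    rw [covDerivAlong_smul hc hg hnd hcd hd, covDerivAlong_smul hc hg hnd hcd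
      (diffAlong_frameField hc u), h1, map_add, map_smul, map_smul, smul_add]
    abel
  refine along_induction hc (P := fun V => DiffAlong E F f (fun y => S (f y) (V y)) x ∧
      covDerivAlong g f (fun y => S (f y) (V y)) x v
        = S (f x) (covDerivAlong g f V x v) + T (V x)) ?_ ?_ ?_ hsmul hV
  · intro V W h hP
    have h' : ∀ᶠ y in 𝓝 x, S (f y) (W y) = S (f y) (V y) := by
      filter_upwards [h] with y hy
      rw [hy]
    refine ⟨hP.1.congr h', ?_⟩
    rw [covDerivAlong_congr g hc h', covDerivAlong_congr g hc h, hP.2, h.self_of_nhds]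
  · simpa only [zero_smul] using hsmul (fun _ => 0) 0 mdifferentiableAt_const
  · intro V W hV hW hPV hPW
    simp only [map_add]
    refine ⟨hPV.1.add hPW.1, ?_⟩
    rw [covDerivAlong_add hc hg hnd hPV.1 hPW.1, covDerivAlong_add hc hg hnd hV hW, hPV.2, hPW.2,
      map_add]
    abel

end Gauss

/-! ### Global sections of distributions and smoothness of orthogonal complements. -/

section Distributions

variable {E : Type*} [NormedAddCommGroup E] [NormedSpace ℝ E]
  {M : Type*} [TopologicalSpace M] [ChartedSpace E M] [IsManifold 𝓘(ℝ, E) ∞ M]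
  {F : Type*} [NormedAddCommGroup F] [NormedSpace ℝ F]
  {N : Type*} [TopologicalSpace N] [ChartedSpace F N] [IsManifold 𝓘(ℝ, F) ∞ N]
  {f : N → M} {x : N}

omit [IsManifold 𝓘(ℝ, F) ∞ N] in
theorem smoothAlongAt_iff {V : ∀ x : N, TangentSpace 𝓘(ℝ, E) (f x)} :
    SmoothAlongAt E F f V x ↔ ContMDiffAt 𝓘(ℝ, F) 𝓘(ℝ, E) ∞ f x ∧
      ContMDiffAt 𝓘(ℝ, F) 𝓘(ℝ, E) ∞ (fun y => coordMap (f x) (f y) (V y)) x := by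
  rw [SmoothAlongAt, contMDiffAt_totalSpace]
  refine and_congr_right fun hf => ?_
  exact Filter.EventuallyEq.contMDiffAt_iff (trivialization_eventuallyEq hf.continuousAt V)

omit [IsManifold 𝓘(ℝ, F) ∞ N] in
theorem SmoothAlongAt.add {V W : ∀ x : N, TangentSpace 𝓘(ℝ, E) (f x)}
    (hV : SmoothAlongAt E F f V x) (hW : SmoothAlongAt E F f W x) :
    SmoothAlongAt E F f (fun y => V y + W y) x := by
  rw [smoothAlongAt_iff] at *
  simp only [map_add]
  exact ⟨hV.1, hV.2.add hW.2⟩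

omit [IsManifold 𝓘(ℝ, F) ∞ N] in
theorem SmoothAlongAt.smul {c : N → ℝ} {V : ∀ x : N, TangentSpace 𝓘(ℝ, E) (f x)}
    (hV : SmoothAlongAt E F f V x) (hc : ContMDiffAt 𝓘(ℝ, F) 𝓘(ℝ, ℝ) ∞ c x) :
    SmoothAlongAt E F f (fun y => c y • V y) x := by
  rw [smoothAlongAt_iff] at *
  simp only [map_smul]
  exact ⟨hV.1, hc.smul hV.2⟩

omit [IsManifold 𝓘(ℝ, F) ∞ N] in
theorem smoothAlongAt_zero (hf : ContMDiffAt 𝓘(ℝ, F) 𝓘(ℝ, E) ∞ f x) :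
    SmoothAlongAt E F f (fun _ => 0) x := by
  rw [smoothAlongAt_iff]
  simp only [map_zero]
  exact ⟨hf, contMDiffAt_const⟩

omit [IsManifold 𝓘(ℝ, F) ∞ N] in
theorem SmoothAlongAt.sum {ι : Type*} (s : Finset ι) (hf : ContMDiffAt 𝓘(ℝ, F) 𝓘(ℝ, E) ∞ f x)
    {V : ι → ∀ x : N, TangentSpace 𝓘(ℝ, E) (f x)} (hV : ∀ i, SmoothAlongAt E F f (V i) x) :
    SmoothAlongAt E F f (fun y => ∑ i ∈ s, V i y) x := by
  classical
  induction s using Finset.induction_on with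
  | empty => simpa only [Finset.sum_empty] using smoothAlongAt_zero hf
  | insert i s hi ih =>
    simp only [Finset.sum_insert hi]
    exact (hV i).add ih

omit [IsManifold 𝓘(ℝ, F) ∞ N] in
theorem SmoothAlongAt.congr {V W : ∀ x : N, TangentSpace 𝓘(ℝ, E) (f x)}
    (hV : SmoothAlongAt E F f V x) (h : ∀ᶠ y in 𝓝 x, W y = V y) :
    SmoothAlongAt E F f W x := by
  refine ContMDiffAt.congr_of_eventuallyEq hV ?_
  filter_upwards [h] with y hy
  rw [hy]

/-- A local section of a family of subspaces can be made global without changing its value at a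
given point. -/
theorem exists_isSectionAlong [FiniteDimensional ℝ F] [T2Space N]
    (hf : ContMDiff 𝓘(ℝ, F) 𝓘(ℝ, E) ∞ f)
    (W : ∀ x : N, Submodule ℝ (TangentSpace 𝓘(ℝ, E) (f x))) {U : Set N} (hU : U ∈ 𝓝 x)
    {V : ∀ x : N, TangentSpace 𝓘(ℝ, E) (f x)} (hV : ∀ y ∈ U, SmoothAlongAt E F f V y)
    (hVW : ∀ y ∈ U, V y ∈ W y) :
    ∃ ξ, IsSectionAlong F f W ξ ∧ ∀ᶠ y in 𝓝 x, ξ y = V y := by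
  obtain ⟨χ, -, hχ⟩ := (SmoothBumpFunction.nhds_basis_tsupport (I := 𝓘(ℝ, F)) x).mem_iff.1 hU
  refine ⟨fun y => χ y • V y, ⟨fun y => ?_, fun y => ?_⟩, ?_⟩
  -- On the closed support of `χ` the field `V` is smooth with values in `W`. Off it the product
  -- vanishes near `y`, whatever `V` is there.
  · by_cases hy : y ∈ tsupport χ
    · exact (hV y (hχ hy)).smul χ.contMDiffAt
    · refine (smoothAlongAt_zero (hf y)).congr ?_
      filter_upwards [(isClosed_tsupport χ).isOpen_compl.mem_nhds hy] with z hz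
      rw [image_eq_zero_of_notMem_tsupport hz, zero_smul]
  · by_cases hy : y ∈ tsupport χ
    · exact (W y).smul_mem _ (hVW y (hχ hy))
    · simp only [image_eq_zero_of_notMem_tsupport hy, zero_smul]
      exact (W y).zero_mem
  · filter_upwards [χ.eventuallyEq_one] with y hy
    rw [hy, Pi.one_apply, one_smul]

/-- Lets a condition on global sections be tested on vectors: a combination of a local frame with
constant coefficients is cut off by a bump function. -/
theorem IsSmoothDistribution.exists_isSection [FiniteDimensional ℝ F] [T2Space N] {k : ℕ}
    {D : ∀ x : N, Submodule ℝ (TangentSpace 𝓘(ℝ, F) x)} (hD : IsSmoothDistribution k D)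
    {u : TangentSpace 𝓘(ℝ, F) x} (hu : u ∈ D x) : ∃ X, IsSection D X ∧ X x = u := by
  obtain ⟨U, hU, hx, X, hX, hs⟩ := hD x
  rw [← (hs x hx).2, Submodule.mem_span_range_iff_exists_fun] at hu
  obtain ⟨c, hc⟩ := hu
  obtain ⟨ξ, h1, h2⟩ := exists_isSectionAlong (f := fun y : N => y) contMDiff_id D
    (hU.mem_nhds hx) (V := fun y => ∑ i, c i • X i y)
    (fun y hy => SmoothAlongAt.sum _ contMDiffAt_id fun i =>
      SmoothAlongAt.smul ((hX i y hy).contMDiffAt (hU.mem_nhds hy)) contMDiffAt_const)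
    (fun y hy => by
      rw [← (hs y hy).2]
      exact Submodule.sum_mem _ fun i _ =>
        Submodule.smul_mem _ _ (Submodule.subset_span (mem_range_self i)))
  exact ⟨ξ, h1, h2.self_of_nhds.trans hc⟩

omit [IsManifold 𝓘(ℝ, F) ∞ N] in
-- In a finite basis, `A` is the sum of the coordinate functionals tensored with the smooth
-- functions `A y (b i)`.
theorem contMDiffAt_clm [FiniteDimensional ℝ F] {G : Type*} [NormedAddCommGroup G]
    [NormedSpace ℝ G] {A : N → F →L[ℝ] G}
    (hA : ∀ e, ContMDiffAt 𝓘(ℝ, F) 𝓘(ℝ, G) ∞ (fun y => A y e) x) :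
    ContMDiffAt 𝓘(ℝ, F) 𝓘(ℝ, F →L[ℝ] G) ∞ A x := by
  let b := Module.finBasis ℝ F
  have h : A = fun y => ∑ i, ContinuousLinearMap.smulRightL ℝ F G
      (LinearMap.toContinuousLinearMap (b.coord i)) (A y (b i)) := by
    ext y e
    conv_lhs => rw [← b.sum_repr e, map_sum]
    rw [sum_apply]
    exact Finset.sum_congr rfl fun i _ => by simp
  rw [h]
  refine contMDiffAt_finsetSum fun i _ => ?_
  exact (ContinuousLinearMap.contMDiff (ContinuousLinearMap.smulRightL ℝ F G
    (LinearMap.toContinuousLinearMap (b.coord i)))).contMDiffAt.comp x (hA (b i))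

/-- A nonzero functional vanishing on the range would have coefficients `φ_i` for which `∑ φ_i X_i`
pairs to zero with every vector. Nondegeneracy makes this combination zero, against independence. -/
theorem surjective_pi_of_linearIndependent {V : Type*} [AddCommGroup V] [Module ℝ V] {k : ℕ}
    (b : V →ₗ[ℝ] V →ₗ[ℝ] ℝ) (hb : ∀ u, (∀ v, b u v = 0) → u = 0) {X : Fin k → V}
    (hX : LinearIndependent ℝ X) : Function.Surjective (LinearMap.pi fun i => b (X i)) := by
  rw [← LinearMap.range_eq_top]
  by_contra hne
  obtain ⟨φ, hφ, hle⟩ := Submodule.exists_le_ker_of_lt_top _ (lt_top_iff_ne_top.2 hne)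
  refine hφ (LinearMap.pi_ext' fun i => LinearMap.ext_ring ?_)
  refine Fintype.linearIndependent_iff.1 hX (fun i => φ (Pi.single i 1)) (hb _ fun v => ?_) i
  have h : φ (LinearMap.pi (fun i => b (X i)) v) = 0 := hle ⟨v, rfl⟩
  rw [LinearMap.pi_apply_eq_sum_univ] at h
  rw [map_sum, LinearMap.sum_apply, ← h]
  refine Finset.sum_congr rfl fun i _ => ?_
  rw [map_smul, LinearMap.smul_apply, smul_eq_mul, smul_eq_mul, mul_comm]
  have e : (Pi.single i 1 : Fin k → ℝ) = fun j => if i = j then 1 else 0 := by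
    ext j
    simp [Pi.single_apply, eq_comm]
  rw [e]
  rfl

variable {g : ∀ p : M, TangentSpace 𝓘(ℝ, E) p →L[ℝ] TangentSpace 𝓘(ℝ, E) p →L[ℝ] ℝ}

/-- The orthogonal complement of a smooth distribution is a smooth distribution. -/
theorem isSmoothDistribution_distPerp [FiniteDimensional ℝ F]
    (hg : IsSemiRiemannianMetric g) (hN : IsNondegenerateSubmanifold F g f) {k : ℕ}
    {D : ∀ x : N, Submodule ℝ (TangentSpace 𝓘(ℝ, F) x)} (hD : IsSmoothDistribution k D) :
    IsSmoothDistribution (Module.finrank ℝ F - k) (distPerp g f D) := by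
  intro x
  have : CompleteSpace F := FiniteDimensional.complete ℝ F
  obtain ⟨U, hU, hxU, X, hX, hs⟩ := hD x
  set b := (trivializationAt F (TangentSpace 𝓘(ℝ, F) : N → Type _) x).baseSet with hb
  have hbo : IsOpen b := (trivializationAt F (TangentSpace 𝓘(ℝ, F) : N → Type _) x).open_baseSet
  have hxb : x ∈ b := FiberBundle.mem_baseSet_trivializationAt' x
  -- In the frame at `x`, the orthogonal complement of `D` at `y` is the kernel of `A y`.
  let A : N → F →L[ℝ] (Fin k → ℝ) := fun y =>
    ContinuousLinearMap.pi fun i => (inducedMetric F g f y (X i y)) ∘L frameMap x y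
  have hA : ∀ y ∈ U ∩ b, ContMDiffAt 𝓘(ℝ, F) 𝓘(ℝ, F →L[ℝ] (Fin k → ℝ)) ∞ A y := by
    intro y hy
    refine contMDiffAt_clm fun e => contMDiffAt_pi_space.2 fun i => ?_
    exact inducedMetric_contMDiffAt hg hN.contMDiff
      ((hX i y hy.1).contMDiffAt (hU.mem_nhds hy.1))
      (smoothFieldAt_frameMap (x := x) hy.2 contMDiffAt_const)
  have hAs : Function.Surjective (A x) := by
    intro a
    let β : TangentSpace 𝓘(ℝ, F) x →ₗ[ℝ] TangentSpace 𝓘(ℝ, F) x →ₗ[ℝ] ℝ :=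
      LinearMap.mk₂ ℝ (fun u v => inducedMetric F g f x u v) (fun _ _ _ => by simp)
        (fun _ _ _ => by simp) (fun _ _ _ => by simp) (fun _ _ _ => by simp)
    obtain ⟨v, hv⟩ := surjective_pi_of_linearIndependent β (hN.nondegenerate x) (hs x hxU).1 a
    refine ⟨coordMap x x v, ?_⟩
    rw [← hv]
    ext i
    change inducedMetric F g f x (X i x) (frameMap x x (coordMap x x v)) = _
    rw [frameMap_coordMap_self]
    rfl
  let K : Submodule ℝ F := (A x : F →ₗ[ℝ] (Fin k → ℝ)).ker
  obtain ⟨pr, hpr⟩ := K.subtype.exists_leftInverse_of_injective K.ker_subtype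
  have hpr' : ∀ κ : K, pr κ = κ := fun κ => LinearMap.congr_fun hpr κ
  have hK : Module.finrank ℝ K = Module.finrank ℝ F - k := by
    have h1 := LinearMap.finrank_range_add_finrank_ker (A x : F →ₗ[ℝ] (Fin k → ℝ))
    rw [LinearMap.range_eq_top.2 hAs, finrank_top, Module.finrank_fin_fun] at h1
    change _ = _ at h1
    have : Module.finrank ℝ K
      = Module.finrank ℝ (A x : F →ₗ[ℝ] (Fin k → ℝ)).ker := rfl
    omega
  let κ : Module.Basis (Fin (Module.finrank ℝ F - k)) ℝ K := Module.finBasisOfFinrankEq ℝ K hK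
  -- Adjoining the fixed projection onto `K = ker (A x)` makes the map bijective at `x`, hence
  -- invertible near `x`. Where it is, its inverse carries `{0} × K` onto `ker (A y)`, so a basis of
  -- `K` yields a frame; it is smooth because inversion of operators is.
  let B : N → F →L[ℝ] (Fin k → ℝ) × K := fun y => (A y).prod (LinearMap.toContinuousLinearMap pr)
  have hBx : Function.Bijective (B x : F →ₗ[ℝ] (Fin k → ℝ) × K) := by
    refine ⟨(injective_iff_map_eq_zero _).2 fun e he => ?_, fun ⟨a, c⟩ => ?_⟩
    · have h1 : A x e = 0 := congrArg Prod.fst he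
      have h2 : pr e = 0 := congrArg Prod.snd he
      have h3 := hpr' ⟨e, h1⟩
      rw [h2] at h3
      exact (congrArg Subtype.val h3).symm
    · obtain ⟨e, he⟩ := hAs a
      have hc : ∀ κ : K, A x κ = 0 := fun κ => κ.2
      refine ⟨e + ((c - pr e : K) : F), Prod.ext ?_ ?_⟩
      · change A x (e + ((c - pr e : K) : F)) = a
        rw [map_add, hc, add_zero, he]
      · change pr (e + ((c - pr e : K) : F)) = c
        rw [map_add, hpr', add_sub_cancel]
  let B₀ : F ≃L[ℝ] (Fin k → ℝ) × K :=
    (LinearEquiv.ofBijective (B x : F →ₗ[ℝ] (Fin k → ℝ) × K) hBx).toContinuousLinearEquiv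
  have hB₀ : (B₀ : F →L[ℝ] (Fin k → ℝ) × K) = B x := by
    ext e <;> rfl
  have hB : ∀ y ∈ U ∩ b, ContMDiffAt 𝓘(ℝ, F) 𝓘(ℝ, F →L[ℝ] (Fin k → ℝ) × K) ∞ B y := fun y hy =>
    contMDiffAt_clm fun e => ((hA y hy).clm_apply contMDiffAt_const).prodMk_space contMDiffAt_const
  have hinv : ∀ᶠ y in 𝓝 x, B y ∈ range ((↑) : (F ≃L[ℝ] (Fin k → ℝ) × K) → _) := by
    refine (hB x ⟨hxU, hxb⟩).continuousAt.eventually ?_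
    rw [← hB₀]
    exact B₀.nhds
  obtain ⟨O, hO, hOo, hxO⟩ := mem_nhds_iff.1
    (hinv.and ((hU.eventually_mem hxU).and (hbo.eventually_mem hxb)))
  refine ⟨O, hOo, hxO, fun j y => frameMap x y ((B y).inverse (0, κ j)), fun j y hy => ?_,
    fun y hy => ?_⟩
  · obtain ⟨⟨Be, hBe⟩, hyU, hyb⟩ := hO hy
    refine ContMDiffAt.contMDiffWithinAt (smoothFieldAt_frameMap hyb ?_)
    have h1 : ContDiffAt ℝ ∞ ContinuousLinearMap.inverse (B y) := hBe ▸ contDiffAt_map_inverse Be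
    exact (h1.contMDiffAt.comp y (hB y ⟨hyU, hyb⟩)).clm_apply contMDiffAt_const
  · obtain ⟨⟨Be, hBe⟩, hyU, hyb⟩ := hO hy
    let L : K →ₗ[ℝ] TangentSpace 𝓘(ℝ, F) y :=
      ((frameMap x y : F →L[ℝ] TangentSpace 𝓘(ℝ, F) y) : F →ₗ[ℝ] TangentSpace 𝓘(ℝ, F) y) ∘ₗ
        (Be.symm : (Fin k → ℝ) × K →ₗ[ℝ] F) ∘ₗ LinearMap.inr ℝ (Fin k → ℝ) K
    have hL : (fun j => frameMap x y ((B y).inverse (0, κ j))) = L ∘ κ := by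
      ext j
      rw [← hBe, ContinuousLinearMap.inverse_equiv]
      rfl
    have hLi : Function.Injective L := by
      refine (injective_iff_map_eq_zero _).2 fun c hc => ?_
      have h1 : coordMap x y (frameMap x y (Be.symm (0, c))) = 0 :=
        (congrArg (coordMap x y) hc).trans (map_zero _)
      rw [coordMap_frameMap hyb] at h1
      have h2 := (map_eq_zero_iff Be.symm Be.symm.injective).1 h1
      exact congrArg Prod.snd h2
    have hBA : ∀ e, A y e = (Be e).1 := fun e => by
      have : Be e = B y e := by rw [← hBe]; rfl
      rw [this]
      rfl
    have hmem : ∀ e, frameMap x y e ∈ distPerp g f D y ↔ A y e = 0 := by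
      intro e
      constructor
      · intro h
        ext i
        refine h (X i y) ?_
        rw [← (hs y hyU).2]
        exact Submodule.subset_span (mem_range_self i)
      · intro h w hw
        rw [← (hs y hyU).2] at hw
        induction hw using Submodule.span_induction with
        | mem w hw =>
          obtain ⟨i, rfl⟩ := hw
          exact congrFun h i
        | zero => rw [map_zero, zero_apply]
        | add u v _ _ h1 h2 => rw [map_add, add_apply, h1, h2, add_zero]
        | smul c u _ h1 => rw [map_smul, smul_apply, h1, smul_zero]
    have hLr : L.range = distPerp g f D y := by
      ext u
      constructor
      · rintro ⟨c, rfl⟩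
        refine (hmem _).2 ?_
        rw [hBA]
        exact congrArg Prod.fst (Be.apply_symm_apply (0, c))
      · intro hu
        rw [← frameMap_coordMap hyb u, hmem, hBA] at hu
        refine ⟨(Be (coordMap x y u)).2, ?_⟩
        change frameMap x y (Be.symm (0, (Be (coordMap x y u)).2)) = u
        rw [← hu, Prod.mk.eta, Be.symm_apply_apply, frameMap_coordMap hyb]
    rw [hL]
    refine ⟨κ.linearIndependent.map' L (LinearMap.ker_eq_bot.2 hLi), ?_⟩
    rw [range_comp, ← Submodule.map_span, κ.span_eq, Submodule.map_top, hLr]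

end Distributions

/-! ### Paraquaternionic CR-submanifolds: tangential and normal parts, and the key identities. -/

section CRSubmanifolds

/-- A nondegenerate subspace is the orthogonal complement of its orthogonal complement. -/
theorem mem_of_orthCompl_orthogonal {V : Type*} [AddCommGroup V] [Module ℝ V] [TopologicalSpace V]
    [IsTopologicalAddGroup V] [ContinuousSMul ℝ V] [FiniteDimensional ℝ V]
    {b : V →L[ℝ] V →L[ℝ] ℝ} (hs : ∀ u v, b u v = b v u)
    (hb : ∀ u, (∀ v, b u v = 0) → u = 0) {W : Submodule ℝ V}
    (hW : ∀ u ∈ W, (∀ v ∈ W, b u v = 0) → u = 0) {u : V}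
    (hu : ∀ w ∈ orthCompl b W, b w u = 0) : u ∈ W := by
  let b' : W →L[ℝ] W →L[ℝ] ℝ := (W.subtypeL.precomp ℝ) ∘L b ∘L W.subtypeL
  -- The orthogonal projection onto `W`, which exists because `b` restricted to `W` is
  -- nondegenerate. Then `u - d` is orthogonal both to `W` and to its complement, hence to every
  -- vector.
  have hdec : ∀ v, ∃ d ∈ W, ∀ w ∈ W, b w (v - d) = 0 := by
    intro v
    have h := sharp_spec b' (fun c hc => Subtype.ext (hW c c.2 fun v hv => hc ⟨v, hv⟩))
      ((b v : V →ₗ[ℝ] ℝ) ∘ₗ W.subtype)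
    refine ⟨_, (sharp b' ((b v : V →ₗ[ℝ] ℝ) ∘ₗ W.subtype)).2, fun w hw => ?_⟩
    rw [map_sub, hs w v, hs w, sub_eq_zero]
    exact (h ⟨w, hw⟩).symm
  obtain ⟨d, hd, hud⟩ := hdec u
  have h0 : u - d = 0 := by
    refine hb _ fun v => ?_
    obtain ⟨c, hc, hvc⟩ := hdec v
    have h1 : b (u - d) (v - c) = 0 := by
      rw [hs, map_sub, hu _ hvc, hs, hvc d hd, sub_zero]
    have h2 : b (u - d) c = 0 := by rw [hs, hud c hc]
    rw [← sub_add_cancel v c, map_add, h1, h2, add_zero]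
  rw [sub_eq_zero.1 h0]
  exact hd

variable {E : Type*} [NormedAddCommGroup E] [NormedSpace ℝ E]
  {M : Type*} [TopologicalSpace M] [ChartedSpace E M] [IsManifold 𝓘(ℝ, E) ∞ M]
  {F : Type*} [NormedAddCommGroup F] [NormedSpace ℝ F]
  {N : Type*} [TopologicalSpace N] [ChartedSpace F N] [IsManifold 𝓘(ℝ, F) ∞ N]
  {g : ∀ p : M, TangentSpace 𝓘(ℝ, E) p →L[ℝ] TangentSpace 𝓘(ℝ, E) p →L[ℝ] ℝ}
  {σ : ∀ p : M, Submodule ℝ (TangentSpace 𝓘(ℝ, E) p →L[ℝ] TangentSpace 𝓘(ℝ, E) p)}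
  {f : N → M} {D : ∀ x : N, Submodule ℝ (TangentSpace 𝓘(ℝ, F) x)} {x : N}
  {U : Set M} {J : Fin 3 → ∀ p : M, TangentSpace 𝓘(ℝ, E) p →L[ℝ] TangentSpace 𝓘(ℝ, E) p}

theorem IsSection.smoothFieldAt {X : ∀ x : N, TangentSpace 𝓘(ℝ, F) x} (hX : IsSection D X)
    (x : N) : SmoothFieldAt F X x := hX.1 x

omit [IsManifold 𝓘(ℝ, E) ∞ M] [IsManifold 𝓘(ℝ, F) ∞ N] in
theorem inducedMetric_tangentialPart [FiniteDimensional ℝ F]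
    (hN : IsNondegenerateSubmanifold F g f) (w : TangentSpace 𝓘(ℝ, E) (f x))
    (v : TangentSpace 𝓘(ℝ, F) x) :
    inducedMetric F g f x (tangentialPart F g f x w) v
      = g (f x) w (mfderiv 𝓘(ℝ, F) 𝓘(ℝ, E) f x v) := by
  have : FiniteDimensional ℝ (TangentSpace 𝓘(ℝ, F) x) := ‹FiniteDimensional ℝ F›
  exact sharp_spec (inducedMetric F g f x) (hN.nondegenerate x)
    ((g (f x) w ∘L mfderiv 𝓘(ℝ, F) 𝓘(ℝ, E) f x : TangentSpace 𝓘(ℝ, F) x →L[ℝ] ℝ) :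
      TangentSpace 𝓘(ℝ, F) x →ₗ[ℝ] ℝ) v

omit [IsManifold 𝓘(ℝ, F) ∞ N] in
theorem normal_apply_mfderiv {n : TangentSpace 𝓘(ℝ, E) (f x)} (hg : IsSemiRiemannianMetric g)
    (hn : n ∈ normalSpace F g f x) (v : TangentSpace 𝓘(ℝ, F) x) :
    g (f x) n (mfderiv 𝓘(ℝ, F) 𝓘(ℝ, E) f x v) = 0 := by
  rw [hg.symm]
  exact hn _ ⟨v, rfl⟩

omit [IsManifold 𝓘(ℝ, F) ∞ N] in
theorem normalPart_mem [FiniteDimensional ℝ F] (hg : IsSemiRiemannianMetric g)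
    (hN : IsNondegenerateSubmanifold F g f) (w : TangentSpace 𝓘(ℝ, E) (f x)) :
    normalPart F g f x w ∈ normalSpace F g f x := by
  rintro _ ⟨v, rfl⟩
  have h := inducedMetric_tangentialPart hN w v
  rw [inducedMetric_apply] at h
  rw [normalPart, map_sub, hg.symm, sub_eq_zero]
  exact h.symm.trans (hg.symm _ _ _)

omit [IsManifold 𝓘(ℝ, F) ∞ N] in
theorem normal_apply_normalPart (hg : IsSemiRiemannianMetric g)
    {n : TangentSpace 𝓘(ℝ, E) (f x)} (hn : n ∈ normalSpace F g f x)
    (w : TangentSpace 𝓘(ℝ, E) (f x)) :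
    g (f x) n (normalPart F g f x w) = g (f x) n w := by
  rw [normalPart, map_sub, normal_apply_mfderiv hg hn, sub_zero]

theorem pqSign_ne_zero (α : Fin 3) : pqSign α ≠ 0 := by
  fin_cases α <;> simp [pqSign]

/-- Put `J_α v` for the second vector in the compatibility relation, use `J_α² = -ε_α`, and cancel
`ε_α`. -/
theorem IsAlmostParaquaternionicHermitian.skew (hM : IsAlmostParaquaternionicHermitian g σ)
    (hJ : IsCanonicalLocalBasis σ U J) {p : M} (hp : p ∈ U) (α : Fin 3)
    (u v : TangentSpace 𝓘(ℝ, E) p) : g p (J α p u) v = -g p u (J α p v) := by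
  have h1 := hM.adapted U J hJ p hp α u (J α p v)
  have h2 : J α p (J α p v) = -pqSign α • v := congrArg (fun A => A v) (hJ.sq p hp α)
  rw [h2, map_smul, smul_eq_mul] at h1
  have h3 := mul_left_cancel₀ (pqSign_ne_zero α)
    (a := pqSign α) (b := -(g p (J α p u) v)) (c := g p u (J α p v)) (by linarith)
  linarith

theorem IsCanonicalLocalBasis.mem (hJ : IsCanonicalLocalBasis σ U J) {p : M} (hp : p ∈ U)
    (α : Fin 3) : J α p ∈ σ p := by
  rw [← hJ.span_eq p hp]
  exact Submodule.subset_span (mem_range_self α)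

omit [IsManifold 𝓘(ℝ, E) ∞ M] [IsManifold 𝓘(ℝ, F) ∞ N] in
theorem mem_nuPerp {S : TangentSpace 𝓘(ℝ, E) (f x) →L[ℝ] TangentSpace 𝓘(ℝ, E) (f x)}
    (hS : S ∈ σ (f x)) {u : TangentSpace 𝓘(ℝ, F) x} (hu : u ∈ distPerp g f D x) :
    S (mfderiv 𝓘(ℝ, F) 𝓘(ℝ, E) f x u) ∈ nuPerp g σ f D x :=
  Submodule.mem_iSup_of_mem S (Submodule.mem_iSup_of_mem hS ⟨_, ⟨u, hu, rfl⟩, rfl⟩)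

theorem nuPerp_le_normalSpace (hM : IsAlmostParaquaternionicHermitian g σ)
    (hN : IsParaquaternionicCR g σ f D) : nuPerp g σ f D x ≤ normalSpace F g f x := by
  obtain ⟨U, J, hx, hJ⟩ := hM.almost (f x)
  rw [nuPerp_eq g σ f D hJ x hx]
  exact iSup_le fun α => hN.totallyReal U J hJ x hx α

/-- The derivative, along `f`, of the vector field `Y` of `N` in the direction `X`. -/
def covDerivTangent (g : ∀ p : M, TangentSpace 𝓘(ℝ, E) p →L[ℝ] TangentSpace 𝓘(ℝ, E) p →L[ℝ] ℝ)
    (f : N → M) (X Y : ∀ x : N, TangentSpace 𝓘(ℝ, F) x) (x : N) : TangentSpace 𝓘(ℝ, E) (f x) :=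
  covDerivAlong g f (fun y => mfderiv 𝓘(ℝ, F) 𝓘(ℝ, E) f y (Y y)) x (X x)

theorem covDerivTangent_torsion [FiniteDimensional ℝ F] (hg : IsSemiRiemannianMetric g)
    (hf : ContMDiff 𝓘(ℝ, F) 𝓘(ℝ, E) ∞ f) {X Y : ∀ x : N, TangentSpace 𝓘(ℝ, F) x}
    (hX : SmoothFieldAt F X x) (hY : SmoothFieldAt F Y x) :
    covDerivTangent g f X Y x - covDerivTangent g f Y X x
      = mfderiv 𝓘(ℝ, F) 𝓘(ℝ, E) f x (VectorField.mlieBracket 𝓘(ℝ, F) X Y x) :=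
  covDerivAlong_torsion hg.symm hf hX.mdifferentiableAt hY.mdifferentiableAt

/-- Symmetry of the second fundamental form: the two derivatives differ by a bracket, which is
tangent and so orthogonal to `n`. -/
theorem normal_apply_covDerivTangent_comm [FiniteDimensional ℝ F] (hg : IsSemiRiemannianMetric g)
    (hf : ContMDiff 𝓘(ℝ, F) 𝓘(ℝ, E) ∞ f) {X Y : ∀ x : N, TangentSpace 𝓘(ℝ, F) x}
    (hX : SmoothFieldAt F X x) (hY : SmoothFieldAt F Y x)
    {n : TangentSpace 𝓘(ℝ, E) (f x)} (hn : n ∈ normalSpace F g f x) :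
    g (f x) n (covDerivTangent g f X Y x) = g (f x) n (covDerivTangent g f Y X x) := by
  rw [← sub_eq_zero, ← map_sub, covDerivTangent_torsion hg hf hX hY,
    normal_apply_mfderiv hg hn]

theorem smoothAlongAt_basis (hN : IsParaquaternionicCR g σ f D)
    (hJ : IsCanonicalLocalBasis σ U J) (hx : f x ∈ U) (α : Fin 3)
    {Z : ∀ x : N, TangentSpace 𝓘(ℝ, F) x} (hZ : SmoothFieldAt F Z x) :
    SmoothAlongAt E F f (fun y => J α (f y) (mfderiv 𝓘(ℝ, F) 𝓘(ℝ, E) f y (Z y))) x :=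
  (hJ.smooth α).smoothAlongAt hJ.isOpen hx (hZ.mfderiv hN.contMDiff)

theorem eventually_mem_of_isCanonicalLocalBasis (hN : IsParaquaternionicCR g σ f D)
    (hJ : IsCanonicalLocalBasis σ U J) (hx : f x ∈ U) : ∀ᶠ y in 𝓝 x, f y ∈ U :=
  hN.contMDiff.continuous.continuousAt.eventually (hJ.isOpen.eventually_mem hx)

theorem apply_basis_mfderiv_eq_zero (hM : IsParaquaternionicKahler g σ)
    (hN : IsParaquaternionicCR g σ f D) (hJ : IsCanonicalLocalBasis σ U J) (hx : f x ∈ U)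
    (α : Fin 3) {u : TangentSpace 𝓘(ℝ, F) x} (hu : u ∈ distPerp g f D x)
    (v : TangentSpace 𝓘(ℝ, F) x) :
    g (f x) (J α (f x) (mfderiv 𝓘(ℝ, F) 𝓘(ℝ, E) f x u))
      (mfderiv 𝓘(ℝ, F) 𝓘(ℝ, E) f x v) = 0 :=
  normal_apply_mfderiv hM.metric
    (nuPerp_le_normalSpace hM.toIsAlmostParaquaternionicHermitian hN
      (mem_nuPerp (hJ.mem hx α) hu)) v

variable [FiniteDimensional ℝ E]

/-- For `Z ∈ Γ(D^⊥)` and tangential `w`, the derivative of `J_α` does not contribute to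
`g(∇_v (J_α Z), w)`. -/
theorem apply_covDerivAlong_basis (hM : IsParaquaternionicKahler g σ)
    (hN : IsParaquaternionicCR g σ f D) (hJ : IsCanonicalLocalBasis σ U J) (hx : f x ∈ U)
    (α : Fin 3) {Z : ∀ x : N, TangentSpace 𝓘(ℝ, F) x} (hZ : IsSection (distPerp g f D) Z)
    (v w : TangentSpace 𝓘(ℝ, F) x) :
    g (f x) (covDerivAlong g f
        (fun y => J α (f y) (mfderiv 𝓘(ℝ, F) 𝓘(ℝ, E) f y (Z y))) x v)
        (mfderiv 𝓘(ℝ, F) 𝓘(ℝ, E) f x w)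
      = g (f x) (J α (f x) (covDerivAlong g f
        (fun y => mfderiv 𝓘(ℝ, F) 𝓘(ℝ, E) f y (Z y)) x v))
        (mfderiv 𝓘(ℝ, F) 𝓘(ℝ, E) f x w) := by
  -- `T` is the derivative of `J_α`. It lies in `σ`, so it sends `Z ∈ D^⊥` into `ν^⊥`, which is
  -- normal to `N`.
  obtain ⟨T, hT, hTV⟩ := hM.parallel_along hJ.isOpen (hJ.smooth α) (fun p hp => hJ.mem hp α) hx
    (hN.contMDiff.mdifferentiable (by simp) x) v
  rw [hTV _ (ContMDiffAt.diffAlong ((hZ.smoothFieldAt x).mfderiv hN.contMDiff)), map_add,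
    add_apply, normal_apply_mfderiv hM.metric
    (nuPerp_le_normalSpace hM.toIsAlmostParaquaternionicHermitian hN (mem_nuPerp hT (hZ.2 x))),
    add_zero]

/-- The key identity: apply `J_α` to both arguments, move it inside the derivative of `Z`, and
differentiate `g(J_α Z, Y) = 0`. Only the value of `Y` at `x` is tied to `y`, so any extension in
`Γ(D)` serves. -/
theorem apply_covDerivTangent_shift (hM : IsParaquaternionicKahler g σ)
    (hN : IsParaquaternionicCR g σ f D) (hJ : IsCanonicalLocalBasis σ U J) (hx : f x ∈ U)
    (α : Fin 3) {X Z Y : ∀ x : N, TangentSpace 𝓘(ℝ, F) x} (hZ : IsSection (distPerp g f D) Z)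
    (hY : IsSection D Y) {y : TangentSpace 𝓘(ℝ, F) x}
    (hy : J α (f x) (mfderiv 𝓘(ℝ, F) 𝓘(ℝ, E) f x y) = mfderiv 𝓘(ℝ, F) 𝓘(ℝ, E) f x (Y x)) :
    pqSign α * g (f x) (covDerivTangent g f X Z x) (mfderiv 𝓘(ℝ, F) 𝓘(ℝ, E) f x y)
      = -g (f x) (J α (f x) (mfderiv 𝓘(ℝ, F) 𝓘(ℝ, E) f x (Z x)))
        (covDerivTangent g f X Y x) := by
  rw [← hM.adapted U J hJ (f x) hx α, hy, covDerivTangent,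
    ← apply_covDerivAlong_basis hM hN hJ hx α hZ]
  refine covDerivAlong_orthogonal hM.metric (smoothAlongAt_basis hN hJ hx α (hZ.smoothFieldAt x))
    ((hY.smoothFieldAt x).mfderiv hN.contMDiff) ?_ (X x)
  filter_upwards [eventually_mem_of_isCanonicalLocalBasis hN hJ hx] with z hz
  exact apply_basis_mfderiv_eq_zero hM hN hJ hz α (hZ.2 z) (Y z)

variable [FiniteDimensional ℝ F]

/-- By symmetry of the second fundamental form both derivatives may be taken in the direction `Y`.
The claim is then the derivative of `g(J_α X, Z) = 0` along `Y`, combined with skewness of `J_α`. -/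
theorem apply_covDerivTangent_symm (hM : IsParaquaternionicKahler g σ)
    (hN : IsParaquaternionicCR g σ f D) (hJ : IsCanonicalLocalBasis σ U J) (hx : f x ∈ U)
    (α : Fin 3) {X Z Y : ∀ x : N, TangentSpace 𝓘(ℝ, F) x} (hX : IsSection (distPerp g f D) X)
    (hZ : IsSection (distPerp g f D) Z) (hY : SmoothFieldAt F Y x) :
    g (f x) (J α (f x) (mfderiv 𝓘(ℝ, F) 𝓘(ℝ, E) f x (Z x))) (covDerivTangent g f X Y x)
      = g (f x) (J α (f x) (mfderiv 𝓘(ℝ, F) 𝓘(ℝ, E) f x (X x)))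
        (covDerivTangent g f Z Y x) := by
  have hn : ∀ {W : ∀ x : N, TangentSpace 𝓘(ℝ, F) x}, IsSection (distPerp g f D) W →
      J α (f x) (mfderiv 𝓘(ℝ, F) 𝓘(ℝ, E) f x (W x)) ∈ normalSpace F g f x := fun hW =>
    nuPerp_le_normalSpace hM.toIsAlmostParaquaternionicHermitian hN
      (mem_nuPerp (hJ.mem hx α) (hW.2 x))
  have hs := hM.toIsAlmostParaquaternionicHermitian.skew hJ hx α
  have h := covDerivAlong_orthogonal hM.metric
    (smoothAlongAt_basis hN hJ hx α (hX.smoothFieldAt x))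
    ((hZ.smoothFieldAt x).mfderiv hN.contMDiff) (by
      filter_upwards [eventually_mem_of_isCanonicalLocalBasis hN hJ hx] with z hz
      exact apply_basis_mfderiv_eq_zero hM hN hJ hz α (hX.2 z) (Z z)) (Y x)
  rw [apply_covDerivAlong_basis hM hN hJ hx α hX, hs, neg_inj, hM.metric.symm] at h
  rw [normal_apply_covDerivTangent_comm hM.metric hN.contMDiff (hX.smoothFieldAt x) hY (hn hZ),
    normal_apply_covDerivTangent_comm hM.metric hN.contMDiff (hZ.smoothFieldAt x) hY (hn hX)]
  exact h

omit [FiniteDimensional ℝ E] [FiniteDimensional ℝ F] in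
theorem exists_basis_mfderiv_eq (hN : IsParaquaternionicCR g σ f D)
    (hJ : IsCanonicalLocalBasis σ U J) (hx : f x ∈ U) (α : Fin 3)
    {y : TangentSpace 𝓘(ℝ, F) x} (hy : y ∈ D x) :
    ∃ w ∈ D x, J α (f x) (mfderiv 𝓘(ℝ, F) 𝓘(ℝ, E) f x w)
      = mfderiv 𝓘(ℝ, F) 𝓘(ℝ, E) f x y := by
  have h : mfderiv 𝓘(ℝ, F) 𝓘(ℝ, E) f x y ∈ tangentImage f x (D x) := ⟨y, hy, rfl⟩
  rw [← hN.paraquaternionic U J hJ x hx α] at h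
  obtain ⟨_, ⟨w, hw, rfl⟩, h⟩ := h
  exact ⟨w, hw, h⟩

omit [FiniteDimensional ℝ E] [FiniteDimensional ℝ F] in
theorem exists_mfderiv_eq_basis (hN : IsParaquaternionicCR g σ f D)
    (hJ : IsCanonicalLocalBasis σ U J) (hx : f x ∈ U) (α : Fin 3)
    {y : TangentSpace 𝓘(ℝ, F) x} (hy : y ∈ D x) :
    ∃ w ∈ D x, J α (f x) (mfderiv 𝓘(ℝ, F) 𝓘(ℝ, E) f x y)
      = mfderiv 𝓘(ℝ, F) 𝓘(ℝ, E) f x w := by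
  have h : J α (f x) (mfderiv 𝓘(ℝ, F) 𝓘(ℝ, E) f x y) ∈ tangentImage f x (D x) := by
    rw [← hN.paraquaternionic U J hJ x hx α]
    exact ⟨_, ⟨y, hy, rfl⟩, rfl⟩
  obtain ⟨w, hw, h⟩ := h
  exact ⟨w, hw, h.symm⟩

/-! ### The canonical totally real foliation and the criteria for it to be totally geodesic. -/

variable [T2Space N]

theorem isFoliation_distPerp (hM : IsParaquaternionicKahler g σ)
    (hN : IsParaquaternionicCR g σ f D) : IsFoliation (distPerp g f D) := by
  obtain ⟨k, hk⟩ := hN.distribution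
  refine ⟨⟨_, isSmoothDistribution_distPerp hM.metric hN.toIsNondegenerateSubmanifold hk⟩,
    fun X Z hX hZ x w hw => ?_⟩
  obtain ⟨U, J, hx, hJ⟩ := hM.almost (f x)
  -- A single index suffices here, and any of the three would do: each `J_α` maps `D` into itself.
  obtain ⟨w', hw', hww'⟩ := exists_mfderiv_eq_basis hN hJ hx 0 hw
  obtain ⟨Y, hY, rfl⟩ := hk.exists_isSection hw'
  have h1 := apply_covDerivTangent_shift (X := X) hM hN hJ hx 0 hZ hY hww'
  have h2 := apply_covDerivTangent_shift (X := Z) hM hN hJ hx 0 hX hY hww'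
  have h3 := apply_covDerivTangent_symm hM hN hJ hx 0 hX hZ (hY.smoothFieldAt x)
  rw [inducedMetric_apply, ← covDerivTangent_torsion hM.metric hN.contMDiff
    (hX.smoothFieldAt x) (hZ.smoothFieldAt x), hM.metric.symm, map_sub, sub_apply, sub_eq_zero]
  refine mul_left_cancel₀ (pqSign_ne_zero 0) ?_
  rw [h1, h2, h3]

/-- The normal part of the derivative of `D` in the direction `D^⊥` is orthogonal to `ν^⊥`. -/
def IsNuPerpOrthogonal
    (g : ∀ p : M, TangentSpace 𝓘(ℝ, E) p →L[ℝ] TangentSpace 𝓘(ℝ, E) p →L[ℝ] ℝ)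
    (σ : ∀ p : M, Submodule ℝ (TangentSpace 𝓘(ℝ, E) p →L[ℝ] TangentSpace 𝓘(ℝ, E) p))
    (f : N → M) (D : ∀ x : N, Submodule ℝ (TangentSpace 𝓘(ℝ, F) x)) : Prop :=
  ∀ X Y : ∀ x : N, TangentSpace 𝓘(ℝ, F) x, IsSection (distPerp g f D) X → IsSection D Y →
    ∀ x, ∀ n ∈ nuPerp g σ f D x, g (f x) n (covDerivTangent g f X Y x) = 0

/-- The Gauss formula turns the left side of `apply_covDerivTangent_shift` into `ε_α h(∇_X Z, y)`.
One `J_α` gives orthogonality of `∇_X Z` to `D`; the converse needs all three, since they span `ν^⊥`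
together. -/
theorem isNuPerpOrthogonal_iff_isTotallyGeodesicFoliation (hM : IsParaquaternionicKahler g σ)
    (hN : IsParaquaternionicCR g σ f D) :
    IsNuPerpOrthogonal g σ f D ↔
      IsTotallyGeodesicFoliation (inducedMetric F g f) (distPerp g f D) := by
  have hfol := isFoliation_distPerp hM hN
  obtain ⟨k, hk⟩ := hN.distribution
  have hgauss : ∀ (X : ∀ x : N, TangentSpace 𝓘(ℝ, F) x) {Z : ∀ x : N, TangentSpace 𝓘(ℝ, F) x},
      IsSection (distPerp g f D) Z → ∀ x (w : TangentSpace 𝓘(ℝ, F) x),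
      inducedMetric F g f x w (leviCivita (inducedMetric F g f) Z x (X x))
        = g (f x) (covDerivTangent g f X Z x) (mfderiv 𝓘(ℝ, F) 𝓘(ℝ, E) f x w) := by
    intro X Z hZ x w
    rw [inducedMetric_symm hM.metric]
    exact (gauss_formula hM.metric hN.toIsNondegenerateSubmanifold (hZ.smoothFieldAt x) _ _).symm
  refine ⟨fun h => ⟨hfol, fun X Z hX hZ x w hw => ?_⟩, fun h X Y hX hY x n hn => ?_⟩
  · obtain ⟨U, J, hx, hJ⟩ := hM.almost (f x)
    obtain ⟨w', hw', hww'⟩ := exists_mfderiv_eq_basis hN hJ hx 0 hw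
    obtain ⟨Y, hY, rfl⟩ := hk.exists_isSection hw'
    have h1 := apply_covDerivTangent_shift (X := X) hM hN hJ hx 0 hZ hY hww'
    rw [h X Y hX hY x _ (mem_nuPerp (hJ.mem hx 0) (hZ.2 x)), neg_zero] at h1
    rw [hgauss X hZ]
    exact (mul_eq_zero.1 h1).resolve_left (pqSign_ne_zero 0)
  · obtain ⟨U, J, hx, hJ⟩ := hM.almost (f x)
    rw [nuPerp_eq g σ f D hJ x hx] at hn
    induction hn using Submodule.iSup_induction' with
    | mem α n hn =>
      obtain ⟨_, ⟨z, hz, rfl⟩, rfl⟩ := hn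
      obtain ⟨k', hk'⟩ := hfol.1
      obtain ⟨Z, hZ, rfl⟩ := hk'.exists_isSection hz
      -- Here `Y` is given, so `y` is obtained from surjectivity of `J_α` on `D`.
      obtain ⟨y, hy, hyY⟩ := exists_basis_mfderiv_eq hN hJ hx α (hY.2 x)
      have h1 := apply_covDerivTangent_shift (X := X) hM hN hJ hx α hZ hY hyY
      rw [← hgauss X hZ, h.2 X Z hX hZ x y hy, mul_zero] at h1
      exact neg_eq_zero.1 h1.symm
    | zero => rw [map_zero, zero_apply]
    | add m n _ _ hm hn => rw [map_add, add_apply, hm, hn, add_zero]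

omit [FiniteDimensional ℝ E] [T2Space N] in
theorem apply_secondFundamentalForm (hM : IsParaquaternionicKahler g σ)
    (hN : IsParaquaternionicCR g σ f D) {X Y : ∀ x : N, TangentSpace 𝓘(ℝ, F) x}
    (hX : IsSection D X) (hY : IsSection (distPerp g f D) Y) (x : N)
    {n : TangentSpace 𝓘(ℝ, E) (f x)} (hn : n ∈ nuPerp g σ f D x) :
    g (f x) n (secondFundamentalForm g f X Y x) = g (f x) n (covDerivTangent g f Y X x) := by
  have hn' := nuPerp_le_normalSpace hM.toIsAlmostParaquaternionicHermitian hN hn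
  rw [← normal_apply_covDerivTangent_comm hM.metric hN.contMDiff (hX.smoothFieldAt x)
    (hY.smoothFieldAt x) hn', secondFundamentalForm, normal_apply_normalPart hM.metric hn']
  rfl

omit [FiniteDimensional ℝ E] [T2Space N] in
-- `B` is always normal, so lying in `ν` only asks for orthogonality to `ν^⊥`.
theorem isNuPerpOrthogonal_iff_secondFundamentalForm (hM : IsParaquaternionicKahler g σ)
    (hN : IsParaquaternionicCR g σ f D) :
    IsNuPerpOrthogonal g σ f D ↔ ∀ X Y : ∀ x : N, TangentSpace 𝓘(ℝ, F) x,
      IsSection D X → IsSection (distPerp g f D) Y →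
      ∀ x, secondFundamentalForm g f X Y x ∈ nu g σ f D x := by
  refine ⟨fun h X Y hX hY x => ⟨normalPart_mem hM.metric hN.toIsNondegenerateSubmanifold _,
    fun n hn => ?_⟩, fun h X Y hX hY x n hn => ?_⟩
  · rw [apply_secondFundamentalForm hM hN hX hY x hn]
    exact h Y X hY hX x n hn
  · rw [← apply_secondFundamentalForm hM hN hY hX x hn]
    exact (h Y X hY hX x).2 n hn

omit [T2Space N] in
-- The Weingarten relation: differentiate `g(ξ, Y) = 0` in the direction `X`.
theorem inducedMetric_shapeOperator (hM : IsParaquaternionicKahler g σ)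
    (hN : IsParaquaternionicCR g σ f D) {ξ : ∀ x : N, TangentSpace 𝓘(ℝ, E) (f x)}
    (hξ : IsSectionAlong F f (nuPerp g σ f D) ξ) (X : ∀ x : N, TangentSpace 𝓘(ℝ, F) x)
    {Y : ∀ x : N, TangentSpace 𝓘(ℝ, F) x} (hY : SmoothFieldAt F Y x) :
    inducedMetric F g f x (Y x) (shapeOperator g f ξ X x)
      = g (f x) (ξ x) (covDerivTangent g f X Y x) := by
  have h := covDerivAlong_orthogonal hM.metric (hξ.1 x) (hY.mfderiv hN.contMDiff)
    (Filter.Eventually.of_forall fun y => normal_apply_mfderiv hM.metric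
      (nuPerp_le_normalSpace hM.toIsAlmostParaquaternionicHermitian hN (hξ.2 y)) (Y y)) (X x)
  rw [shapeOperator, map_neg, inducedMetric_symm hM.metric,
    inducedMetric_tangentialPart hN.toIsNondegenerateSubmanifold, h, neg_neg]
  rfl

omit [FiniteDimensional ℝ E] in
-- The canonical basis exists only over `U`, so `J_α Z` is cut off there by a bump function. Such
-- sections realize the generators of `ν^⊥` at a point, which is what passing from vectors `n` to
-- global sections `ξ` needs.
theorem exists_isSectionAlong_nuPerp (hN : IsParaquaternionicCR g σ f D)
    (hJ : IsCanonicalLocalBasis σ U J) (hx : f x ∈ U) (α : Fin 3)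
    {Z : ∀ x : N, TangentSpace 𝓘(ℝ, F) x} (hZ : IsSection (distPerp g f D) Z) :
    ∃ ξ, IsSectionAlong F f (nuPerp g σ f D) ξ ∧
      ξ x = J α (f x) (mfderiv 𝓘(ℝ, F) 𝓘(ℝ, E) f x (Z x)) := by
  obtain ⟨ξ, hξ, h⟩ := exists_isSectionAlong hN.contMDiff (nuPerp g σ f D)
    (eventually_mem_of_isCanonicalLocalBasis hN hJ hx)
    (V := fun y => J α (f y) (mfderiv 𝓘(ℝ, F) 𝓘(ℝ, E) f y (Z y)))
    (fun y hy => smoothAlongAt_basis hN hJ hy α (hZ.smoothFieldAt y))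
    (fun y hy => mem_nuPerp (hJ.mem hy α) (hZ.2 y))
  exact ⟨ξ, hξ, h.self_of_nhds⟩

theorem isNuPerpOrthogonal_iff_forall_section (hM : IsParaquaternionicKahler g σ)
    (hN : IsParaquaternionicCR g σ f D) :
    IsNuPerpOrthogonal g σ f D ↔ ∀ ξ, IsSectionAlong F f (nuPerp g σ f D) ξ →
      ∀ X Y : ∀ x : N, TangentSpace 𝓘(ℝ, F) x, IsSection (distPerp g f D) X → IsSection D Y →
      ∀ x, g (f x) (ξ x) (covDerivTangent g f X Y x) = 0 := by
  refine ⟨fun h ξ hξ X Y hX hY x => h X Y hX hY x _ (hξ.2 x), fun h X Y hX hY x n hn => ?_⟩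
  obtain ⟨U, J, hx, hJ⟩ := hM.almost (f x)
  rw [nuPerp_eq g σ f D hJ x hx] at hn
  induction hn using Submodule.iSup_induction' with
  | mem α n hn =>
    obtain ⟨_, ⟨z, hz, rfl⟩, rfl⟩ := hn
    obtain ⟨k, hk⟩ := (isFoliation_distPerp hM hN).1
    obtain ⟨Z, hZ, rfl⟩ := hk.exists_isSection hz
    obtain ⟨ξ, hξ, hξx⟩ := exists_isSectionAlong_nuPerp hN hJ hx α hZ
    have h1 := h ξ hξ X Y hX hY x
    rw [hξx] at h1
    exact h1
  | zero => rw [map_zero, zero_apply]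
  | add m n _ _ hm hn => rw [map_add, add_apply, hm, hn, add_zero]

theorem isNuPerpOrthogonal_iff_shapeOperator_distPerp (hM : IsParaquaternionicKahler g σ)
    (hN : IsParaquaternionicCR g σ f D) :
    IsNuPerpOrthogonal g σ f D ↔
      ∀ (ξ : ∀ x : N, TangentSpace 𝓘(ℝ, E) (f x)) (X : ∀ x : N, TangentSpace 𝓘(ℝ, F) x),
        IsSectionAlong F f (nuPerp g σ f D) ξ → IsSection (distPerp g f D) X →
        ∀ x, shapeOperator g f ξ X x ∈ distPerp g f D x := by
  rw [isNuPerpOrthogonal_iff_forall_section hM hN]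
  obtain ⟨k, hk⟩ := hN.distribution
  refine ⟨fun h ξ X hξ hX x w hw => ?_, fun h ξ hξ X Y hX hY x => ?_⟩
  · obtain ⟨Y, hY, rfl⟩ := hk.exists_isSection hw
    rw [inducedMetric_shapeOperator hM hN hξ X (hY.smoothFieldAt x)]
    exact h ξ hξ X Y hX hY x
  · rw [← inducedMetric_shapeOperator hM hN hξ X (hY.smoothFieldAt x)]
    exact h ξ X hξ hX x (Y x) (hY.2 x)

theorem isNuPerpOrthogonal_iff_shapeOperator (hM : IsParaquaternionicKahler g σ)
    (hN : IsParaquaternionicCR g σ f D) :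
    IsNuPerpOrthogonal g σ f D ↔
      ∀ (ξ : ∀ x : N, TangentSpace 𝓘(ℝ, E) (f x)) (Y : ∀ x : N, TangentSpace 𝓘(ℝ, F) x),
        IsSectionAlong F f (nuPerp g σ f D) ξ → IsSection D Y →
        ∀ x, shapeOperator g f ξ Y x ∈ D x := by
  rw [isNuPerpOrthogonal_iff_forall_section hM hN]
  obtain ⟨k, hk⟩ := (isFoliation_distPerp hM hN).1
  have hcomm : ∀ {ξ : ∀ x : N, TangentSpace 𝓘(ℝ, E) (f x)} {X Y : ∀ x : N, TangentSpace 𝓘(ℝ, F) x},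
      IsSectionAlong F f (nuPerp g σ f D) ξ → IsSection (distPerp g f D) X → IsSection D Y →
      ∀ x, inducedMetric F g f x (X x) (shapeOperator g f ξ Y x)
        = g (f x) (ξ x) (covDerivTangent g f X Y x) := by
    intro ξ X Y hξ hX hY x
    rw [inducedMetric_shapeOperator hM hN hξ Y (hX.smoothFieldAt x)]
    exact normal_apply_covDerivTangent_comm hM.metric hN.contMDiff (hY.smoothFieldAt x)
      (hX.smoothFieldAt x)
      (nuPerp_le_normalSpace hM.toIsAlmostParaquaternionicHermitian hN (hξ.2 x))
  refine ⟨fun h ξ Y hξ hY x => ?_, fun h ξ hξ X Y hX hY x => ?_⟩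
  · have : FiniteDimensional ℝ (TangentSpace 𝓘(ℝ, F) x) := ‹FiniteDimensional ℝ F›
    -- Nondegeneracy of `h` on `D` gives `D = (D^⊥)^⊥`, so membership in `D` is tested against
    -- `D^⊥`.
    refine mem_of_orthCompl_orthogonal (inducedMetric_symm hM.metric x) (hN.nondegenerate x)
      (hN.dist_nondegenerate x) fun w hw => ?_
    obtain ⟨X, hX, rfl⟩ := hk.exists_isSection hw
    rw [hcomm hξ hX hY]
    exact h ξ hξ X Y hX hY x
  · rw [← hcomm hξ hX hY, inducedMetric_symm hM.metric]
    exact hX.2 x _ (h ξ Y hξ hY x)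

end CRSubmanifolds

end

theorem mainTheorem5
    {E : Type*} [NormedAddCommGroup E] [NormedSpace ℝ E] [FiniteDimensional ℝ E]
    {M : Type*} [TopologicalSpace M] [T2Space M] [ChartedSpace E M] [IsManifold 𝓘(ℝ, E) ∞ M]
    {F : Type*} [NormedAddCommGroup F] [NormedSpace ℝ F] [FiniteDimensional ℝ F]
    {N : Type*} [TopologicalSpace N] [T2Space N] [ChartedSpace F N] [IsManifold 𝓘(ℝ, F) ∞ N]
    (g : ∀ p : M, TangentSpace 𝓘(ℝ, E) p →L[ℝ] TangentSpace 𝓘(ℝ, E) p →L[ℝ] ℝ)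
    (σ : ∀ p : M, Submodule ℝ (TangentSpace 𝓘(ℝ, E) p →L[ℝ] TangentSpace 𝓘(ℝ, E) p))
    (hM : IsParaquaternionicKahler g σ)
    (f : N → M) (D : ∀ x : N, Submodule ℝ (TangentSpace 𝓘(ℝ, F) x))
    (hN : IsParaquaternionicCR g σ f D) :
    IsFoliation (distPerp g f D) ∧
    List.TFAE [
      IsTotallyGeodesicFoliation (inducedMetric F g f) (distPerp g f D),
      ∀ X Y : ∀ x : N, TangentSpace 𝓘(ℝ, F) x,
        IsSection D X → IsSection (distPerp g f D) Y →
        ∀ x, secondFundamentalForm g f X Y x ∈ nu g σ f D x,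
      ∀ (ξ : ∀ x : N, TangentSpace 𝓘(ℝ, E) (f x)) (X : ∀ x : N, TangentSpace 𝓘(ℝ, F) x),
        IsSectionAlong F f (nuPerp g σ f D) ξ → IsSection (distPerp g f D) X →
        ∀ x, shapeOperator g f ξ X x ∈ distPerp g f D x,
      ∀ (ξ : ∀ x : N, TangentSpace 𝓘(ℝ, E) (f x)) (Y : ∀ x : N, TangentSpace 𝓘(ℝ, F) x),
        IsSectionAlong F f (nuPerp g σ f D) ξ → IsSection D Y →
        ∀ x, shapeOperator g f ξ Y x ∈ D x] ∧
    (IsMixedGeodesic g f D →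
      IsTotallyGeodesicFoliation (inducedMetric F g f) (distPerp g f D)) ∧
    ((∀ x, nu g σ f D x = ⊥) →
      (IsTotallyGeodesicFoliation (inducedMetric F g f) (distPerp g f D) ↔
        IsMixedGeodesic g f D)) := by
  have h1 := isNuPerpOrthogonal_iff_isTotallyGeodesicFoliation hM hN
  have h2 := isNuPerpOrthogonal_iff_secondFundamentalForm hM hN
  refine ⟨isFoliation_distPerp hM hN, ?_, fun hmix => ?_, fun hnu => ?_⟩
  · tfae_have 1 ↔ 2 := h1.symm.trans h2
    tfae_have 1 ↔ 3 := h1.symm.trans (isNuPerpOrthogonal_iff_shapeOperator_distPerp hM hN)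
    tfae_have 1 ↔ 4 := h1.symm.trans (isNuPerpOrthogonal_iff_shapeOperator hM hN)
    tfae_finish
  · refine (h1.symm.trans h2).2 fun X Y hX hY x => ?_
    rw [hmix X Y hX hY x]
    exact Submodule.zero_mem _
  · rw [← h1, h2]
    refine forall₅_congr fun X Y hX hY x => ?_
    rw [hnu x, Submodule.mem_bot]
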